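/- Let $a<b$ be real numbers. Let $K\colon\mathbb{R}\to[0,+\infty)$ be measurable, even (it suffices that $K(-z)=K(z)$ for a.e. $z$), not a.e. equal to $0$, and such that $\int_{\mathbb{R}}K(z)(1+|z|^2)\,dz<+\infty$. Put $K_h(z)=h^{-1}K(z/h)$ for $h>0$. Let $f\colon[0,+\infty)\to[0,+\infty)$ be of class $C^2$ with $f(0)=f'(0)=0$, and suppose that there is $\gamma>0$ such that $f''(t)\ge\gamma$ for all $t\ge 0$ (derivatives at $0$ are one-sided). For $h>0$ and $u\in H^1(\mathbb{R})$ (real-valued) let $$\mathcal{E}_h(u)=\frac1{h^2}\int_{\mathbb{R}}\int_{\mathbb{R}}K_h(z)\left[f(|u'(x)|)-f\left(\left|\frac{u(x+z)-u(x)}{z}\right|\right)\right]dz\,dx ,$$ where the double integral is the difference of the integrals of the positive and the negative part of the integrand over $\mathbb{R}\times\mathbb{R}$, and is $+\infty$ if the integral of the positive part is $+\infty$. Let $X=\{u\in H^1(\mathbb{R}): u=0 \text{ a.e. in }\mathbb{R}\setminus(a,b)\}$, endowed with the topology of $H^1(\mathbb{R})$, and for $u\in X$ let $$\mathcal{E}_0(u)=\begin{cases}\displaystyle\frac1{24}\left(\int_{\mathbb{R}}K(z)z^2\,dz\right)\int_{\mathbb{R}}f''(|u'(x)|)\,|u''(x)|^2\,dx&\text{if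 }u\in H^2(\mathbb{R}),\\+\infty&\text{otherwise.}\end{cases}$$ Then the restrictions of $\mathcal{E}_h$ to $X$ $\Gamma$-converge to $\mathcal{E}_0$ in the $H^1(\mathbb{R})$-topology as $h\searrow0$; that is, for every $u\in X$: 1. for every family $(u_h)_{h>0}\subset X$ with $u_h\to u$ in $H^1(\mathbb{R})$ as $h\searrow 0$ one has $\mathcal{E}_0(u)\le\liminf_{h\searrow0}\mathcal{E}_h(u_h)$; 2. there is a family $(u_h)_{h>0}\subset X$ with $u_h\to u$ in $H^1(\mathbb{R})$ as $h\searrow 0$ and $\limsup_{h\searrow0}\mathcal{E}_h(u_h)\le\mathcal{E}_0(u)$. -/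

import Mathlib

open MeasureTheory Filter Topology Set
open scoped ContDiff

/-- The Lebesgue space `L²(ℝ)` of real-valued functions on the line. -/
abbrev L2R : Type := Lp ℝ 2 (volume : Measure ℝ)

/-- `v ∈ L²(ℝ)` is the weak derivative of `u ∈ L²(ℝ)`: for every test function `φ ∈ C_c^∞(ℝ)`,
`∫ u φ' = - ∫ v φ`. -/
def IsWeakDeriv (u v : L2R) : Prop :=
  ∀ φ : ℝ → ℝ, ContDiff ℝ ∞ φ → HasCompactSupport φ →
    ∫ x, u x * deriv φ x = - ∫ x, v x * φ x

theorem L2R.integrable_mul (u : L2R) {φ : ℝ → ℝ} (hφ : Continuous φ)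
    (hc : HasCompactSupport φ) : Integrable (fun x => u x * φ x) :=
  MemLp.integrable_mul (p := 2) (q := 2) (Lp.memLp u) (hφ.memLp_of_hasCompactSupport hc)

theorem IsWeakDeriv.add {u v u' v' : L2R} (h : IsWeakDeriv u v) (h' : IsWeakDeriv u' v') :
    IsWeakDeriv (u + u') (v + v') := by
  intro φ hφ hc
  have hd : Continuous (deriv φ) := hφ.continuous_deriv (by simp)
  have e1 : ∫ x, (u + u') x * deriv φ x = ∫ x, (u x * deriv φ x + u' x * deriv φ x) := by
    refine integral_congr_ae ?_
    filter_upwards [Lp.coeFn_add u u'] with x hx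
    rw [hx, Pi.add_apply, add_mul]
  have e2 : ∫ x, (v + v') x * φ x = ∫ x, (v x * φ x + v' x * φ x) := by
    refine integral_congr_ae ?_
    filter_upwards [Lp.coeFn_add v v'] with x hx
    rw [hx, Pi.add_apply, add_mul]
  rw [e1, e2, integral_add (u.integrable_mul hd hc.deriv) (u'.integrable_mul hd hc.deriv),
    integral_add (v.integrable_mul hφ.continuous hc) (v'.integrable_mul hφ.continuous hc),
    h φ hφ hc, h' φ hφ hc]
  ring

theorem IsWeakDeriv.smul {u v : L2R} (c : ℝ) (h : IsWeakDeriv u v) :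
    IsWeakDeriv (c • u) (c • v) := by
  intro φ hφ hc
  have e1 : ∫ x, (c • u) x * deriv φ x = ∫ x, c * (u x * deriv φ x) := by
    refine integral_congr_ae ?_
    filter_upwards [Lp.coeFn_smul c u] with x hx
    rw [hx, Pi.smul_apply, smul_eq_mul, mul_assoc]
  have e2 : ∫ x, (c • v) x * φ x = ∫ x, c * (v x * φ x) := by
    refine integral_congr_ae ?_
    filter_upwards [Lp.coeFn_smul c v] with x hx
    rw [hx, Pi.smul_apply, smul_eq_mul, mul_assoc]
  rw [e1, e2, integral_const_mul, integral_const_mul, h φ hφ hc]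
  ring

theorem IsWeakDeriv.zero : IsWeakDeriv 0 0 := by
  have h : IsWeakDeriv ((0 : ℝ) • (0 : L2R)) ((0 : ℝ) • (0 : L2R)) := by
    intro φ _ _
    have e : ∀ ψ : ℝ → ℝ, ∫ x, ((0 : ℝ) • (0 : L2R)) x * ψ x = 0 := by
      intro ψ
      rw [integral_eq_zero_of_ae]
      filter_upwards [Lp.coeFn_smul (0 : ℝ) (0 : L2R)] with x hx
      rw [hx]
      simp
    rw [e, e, neg_zero]
  simpa using h

/-- The Sobolev space `H¹(ℝ)`. An element is a pair `(u, u')` of an `L²` function and its weak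
derivative in `L²` (which is unique, so that the pair is determined by `u`). The norm that it
inherits is the `H¹` norm `(‖u‖² + ‖u'‖²)^(1/2)`. -/
def sobolevH1 : Submodule ℝ (WithLp 2 (L2R × L2R)) where
  carrier := {p | IsWeakDeriv p.fst p.snd}
  add_mem' := fun h h' => IsWeakDeriv.add h h'
  zero_mem' := IsWeakDeriv.zero
  smul_mem' := fun c _ h => IsWeakDeriv.smul c h

/-- `H¹(ℝ)` as a type, with the `H¹` norm. -/
abbrev H1 : Type := ↥sobolevH1

namespace H1

/-- The function `u` itself. -/
noncomputable def fn (u : H1) : ℝ → ℝ := u.1.fst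

/-- The weak derivative `u'`. -/
noncomputable def weakDeriv (u : H1) : ℝ → ℝ := u.1.snd

/-- `u ∈ H²(ℝ)`: the weak derivative `u'` has a weak derivative in `L²(ℝ)`. -/
def MemH2 (u : H1) : Prop := ∃ w : L2R, IsWeakDeriv u.1.snd w

open Classical in
/-- The second weak derivative `u''` of `u ∈ H²(ℝ)` (and `0` if `u ∉ H²(ℝ)`). -/
noncomputable def weakDeriv₂ (u : H1) : ℝ → ℝ :=
  if h : MemH2 u then (h.choose : L2R) else 0

end H1

/-- The space `X` of those `u ∈ H¹(ℝ)` that vanish a.e. outside the interval `(a, b)`. -/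
def SpaceX (a b : ℝ) : Set H1 := {u | ∀ᵐ x, x ∉ Ioo a b → u.fn x = 0}

open Classical in
/-- The extended Lebesgue integral `∫ g⁺ - ∫ g⁻ ∈ [-∞, +∞]`, equal to `+∞` whenever
`∫ g⁺ = +∞`. -/
noncomputable def extIntegral {α : Type*} [MeasurableSpace α] (μ : Measure α) (g : α → ℝ) :
    EReal :=
  if ∫⁻ x, ENNReal.ofReal (g x) ∂μ = ⊤ then ⊤
  else ((∫⁻ x, ENNReal.ofReal (g x) ∂μ : ENNReal) : EReal)
    - ((∫⁻ x, ENNReal.ofReal (-(g x)) ∂μ : ENNReal) : EReal)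

/-- The rescaled kernel `K_h(z) = h⁻¹ K(z / h)`. -/
noncomputable def rescaledKernel (K : ℝ → ℝ) (h z : ℝ) : ℝ := h⁻¹ * K (z / h)

/-- The rate functional
`ℰ_h(u) = h⁻² ∫∫ K_h(z) [f(|u'(x)|) - f(|(u(x+z) - u(x)) / z|)] dz dx`. The variable of
integration is `p = (x, z)`. -/
noncomputable def rateFunctional (f K : ℝ → ℝ) (h : ℝ) (u : H1) : EReal :=
  ((1 / h ^ 2 : ℝ) : EReal) * extIntegral (volume : Measure (ℝ × ℝ)) (fun p =>
    rescaledKernel K h p.2 *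
      (f |u.weakDeriv p.1| - f |(u.fn (p.1 + p.2) - u.fn p.1) / p.2|))

open Classical in
/-- The limit functional
`ℰ_0(u) = (1/24) (∫ K(z) z² dz) ∫ f''(|u'(x)|) |u''(x)|² dx` if `u ∈ H²(ℝ)`, and `+∞` otherwise.
Here `f''` is the second derivative of `f` on the half-line `[0, +∞)`. -/
noncomputable def limitFunctional (f K : ℝ → ℝ) (u : H1) : EReal :=
  if u.MemH2 then
    ((1 / 24 * ∫ z, K z * z ^ 2 : ℝ) : EReal) *
      ((∫⁻ x, ENNReal.ofReal
        (iteratedDerivWithin 2 f (Ici 0) |u.weakDeriv x| * |u.weakDeriv₂ x| ^ 2) : ENNReal) : EReal)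
  else ⊤

/-- `Γ`-convergence of a family of functionals `F i` on a topological space to `F₀`, along the
filter `l` and through families: for every `u`, the lower limit inequality for all
families converging to `u`, and the existence of a recovery family. -/
def GammaConverges {ι E : Type*} [TopologicalSpace E] (l : Filter ι) (F : ι → E → EReal)
    (F₀ : E → EReal) : Prop :=
  ∀ u : E,
    (∀ w : ι → E, Tendsto w l (𝓝 u) → F₀ u ≤ liminf (fun i => F i (w i)) l) ∧
    (∃ w : ι → E, Tendsto w l (𝓝 u) ∧ limsup (fun i => F i (w i)) l ≤ F₀ u)

/-!
Write `v = u'`, and extend `f` evenly to a potential on the line with second derivative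
`ψ t = f''(|t|) ≥ γ` (`eq_potential_of_contDiffOn`). The difference quotient of `u` with step `s` is
the mean of `v` over the segment from `x` to `x + s`, so `∫ f(|v|) - ∫ f(|difference quotient|)` is
the integral over `x` of the gap in Jensen's inequality for that mean. By Taylor's formula the gap
equals `∫₀¹ A (v(x + τ s) - m)² dτ`, where `m` is the mean and the weight `A` lies above `γ / 2` and
tends to `ψ(v(x)) / 2` when `v(x + τ s)` and `m` tend to `v(x)`. After the substitution `z = h y`,
the functional becomes an integral of such weighted `L²` norms over `y` and `τ`
(`rateFunctional_eq_lintegral_gap`). If the potential of `v` is not integrable, the functional is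
infinite (`rateFunctional_eq_top`), since the means over segments of fixed length always have an
integrable potential.

For fixed `y` and `τ`, the functions `(v(x + τ h y) - m) / h` tend to `y (τ - 1/2) v'`. When `v`
varies with `h` and converges in `L²`, this holds in the sense of distributions, because the
operation has an adjoint of the same form that can be moved to the test function
(`tendsto_inner_differenceQuotient`). Weighted `L²` norms are lower semicontinuous under this
convergence (`exists_limit_of_weighted_bound`): multiplied by `√A`, the functions stay bounded in
`L²` and have a weak limit, and division by the limit of `√A` recovers the derivative of `v`. In
particular a finite lower limit forces `v` to have a weak derivative. Fatou's lemma in `y` and `τ`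
gives the lower bound (`le_liminf_lintegral_gap`); the constant `1/24` is one half of
`∫₀¹ (τ - 1/2)² dτ = 1/12`.

When `v` is fixed and has a weak derivative, it is bounded, the weights are bounded, and the
convergence above is strong in `L²`. Dominated convergence then gives convergence of the functionals
(`tendsto_lintegral_gap`), so the constant family is a recovery family.
-/

/-! ### A convex potential and its Bregman distance -/

/-- The primitive of `ψ` that vanishes at `0`. -/
noncomputable def slope₀ (ψ : ℝ → ℝ) (t : ℝ) : ℝ := ∫ s in (0 : ℝ)..t, ψ s

/-- The potential with second derivative `ψ` that vanishes to first order at `0`. -/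
noncomputable def potential (ψ : ℝ → ℝ) (t : ℝ) : ℝ := ∫ s in (0 : ℝ)..t, slope₀ ψ s

/-- The weighted mean of the second derivative `ψ` over the segment from `p` to `q` that occurs in
the Taylor remainder of the potential. The weight `1 - r` has integral `1 / 2`. -/
noncomputable def taylorWeight (ψ : ℝ → ℝ) (p q : ℝ) : ℝ :=
  ∫ r in (0 : ℝ)..1, (1 - r) * ψ (p + r * (q - p))

/-- The Bregman distance of the potential, written as a weight times the squared distance. That it
is the second order Taylor remainder is `potential_eq_add_bregman`. -/
noncomputable def bregman (ψ : ℝ → ℝ) (p q : ℝ) : ℝ := taylorWeight ψ p q * (q - p) ^ 2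

section Potential

variable {ψ : ℝ → ℝ}

theorem hasDerivAt_slope₀ (hψ : Continuous ψ) (t : ℝ) : HasDerivAt (slope₀ ψ) (ψ t) t :=
  intervalIntegral.integral_hasDerivAt_right (hψ.intervalIntegrable _ _)
    (hψ.stronglyMeasurableAtFilter _ _) hψ.continuousAt

theorem continuous_slope₀ (hψ : Continuous ψ) : Continuous (slope₀ ψ) :=
  continuous_iff_continuousAt.2 fun t => (hasDerivAt_slope₀ hψ t).continuousAt

theorem hasDerivAt_potential (hψ : Continuous ψ) (t : ℝ) :
    HasDerivAt (potential ψ) (slope₀ ψ t) t :=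
  hasDerivAt_slope₀ (continuous_slope₀ hψ) t

theorem continuous_potential (hψ : Continuous ψ) : Continuous (potential ψ) :=
  continuous_slope₀ (continuous_slope₀ hψ)

/-- Taylor's formula with integral remainder. -/
theorem potential_eq_add_bregman (hψ : Continuous ψ) (p q : ℝ) :
    potential ψ q = potential ψ p + slope₀ ψ p * (q - p) + bregman ψ p q := by
  have hd : ∀ r : ℝ, HasDerivAt
      (fun r => (1 - r) * slope₀ ψ (p + r * (q - p)) * (q - p) + potential ψ (p + r * (q - p)))
      ((1 - r) * ψ (p + r * (q - p)) * (q - p) ^ 2) r := by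
    intro r
    have hl : HasDerivAt (fun r : ℝ => p + r * (q - p)) (q - p) r := by
      simpa using ((hasDerivAt_id r).mul_const (q - p)).const_add p
    have h1 := (hasDerivAt_slope₀ hψ (p + r * (q - p))).comp r hl
    have h2 := (hasDerivAt_potential hψ (p + r * (q - p))).comp r hl
    have h3 : HasDerivAt (fun r : ℝ => 1 - r) (-1) r := by
      simpa using (hasDerivAt_id r).const_sub 1
    refine (((h3.mul h1).mul_const (q - p)).add h2).congr_deriv ?_
    simp only [Function.comp]
    ring
  have hc : Continuous fun r : ℝ => (1 - r) * ψ (p + r * (q - p)) * (q - p) ^ 2 := by fun_prop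
  have := intervalIntegral.integral_eq_sub_of_hasDerivAt (a := 0) (b := 1) (fun r _ => hd r)
    (hc.intervalIntegrable _ _)
  rw [intervalIntegral.integral_mul_const] at this
  simp only [bregman, taylorWeight, this]
  simp
  ring

theorem continuous_taylorWeight (hψ : Continuous ψ) :
    Continuous fun x : ℝ × ℝ => taylorWeight ψ x.1 x.2 := by
  refine intervalIntegral.continuous_parametric_intervalIntegral_of_continuous' (μ := volume)
    (f := fun (x : ℝ × ℝ) r => (1 - r) * ψ (x.1 + r * (x.2 - x.1))) ?_ 0 1
  simp only [Function.uncurry_def]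
  fun_prop

theorem continuous_bregman (hψ : Continuous ψ) :
    Continuous fun x : ℝ × ℝ => bregman ψ x.1 x.2 := by
  have := continuous_taylorWeight hψ
  unfold bregman
  fun_prop

theorem integral_one_sub : ∫ r in (0 : ℝ)..1, (1 - r) = 1 / 2 := by
  rw [intervalIntegral.integral_sub (by simp) (by simp)]
  simp
  norm_num

theorem taylorWeight_self (p : ℝ) : taylorWeight ψ p p = ψ p / 2 := by
  have : ∀ r : ℝ, (1 - r) * ψ (p + r * (p - p)) = (1 - r) * ψ p := by simp
  simp only [taylorWeight, this, intervalIntegral.integral_mul_const, integral_one_sub]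
  ring

theorem le_taylorWeight {γ : ℝ} (hψ : Continuous ψ) (hγ : ∀ t, γ ≤ ψ t) (p q : ℝ) :
    γ / 2 ≤ taylorWeight ψ p q := by
  have h : ∫ r in (0 : ℝ)..1, (1 - r) * γ ≤ taylorWeight ψ p q := by
    refine intervalIntegral.integral_mono_on zero_le_one
      (Continuous.intervalIntegrable (by fun_prop) _ _)
      (Continuous.intervalIntegrable (by fun_prop) _ _) fun r hr => ?_
    exact mul_le_mul_of_nonneg_left (hγ _) (by linarith [hr.2])
  rw [intervalIntegral.integral_mul_const, integral_one_sub] at h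
  linarith

theorem taylorWeight_pos {γ : ℝ} (hψ : Continuous ψ) (hγ0 : 0 < γ) (hγ : ∀ t, γ ≤ ψ t)
    (p q : ℝ) : 0 < taylorWeight ψ p q :=
  (half_pos hγ0).trans_le (le_taylorWeight hψ hγ p q)

theorem bregman_nonneg {γ : ℝ} (hψ : Continuous ψ) (hγ0 : 0 < γ) (hγ : ∀ t, γ ≤ ψ t)
    (p q : ℝ) : 0 ≤ bregman ψ p q :=
  mul_nonneg (taylorWeight_pos hψ hγ0 hγ p q).le (sq_nonneg _)

theorem potential_eq_bregman (hψ : Continuous ψ) (q : ℝ) :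
    potential ψ q = taylorWeight ψ 0 q * q ^ 2 := by
  rw [potential_eq_add_bregman hψ 0 q]
  simp [potential, slope₀, bregman]

theorem potential_nonneg {γ : ℝ} (hψ : Continuous ψ) (hγ0 : 0 < γ) (hγ : ∀ t, γ ≤ ψ t)
    (q : ℝ) : 0 ≤ potential ψ q := by
  rw [potential_eq_bregman hψ]
  exact mul_nonneg (taylorWeight_pos hψ hγ0 hγ _ _).le (sq_nonneg _)

/-- On bounded sets the Taylor weight is bounded. -/
theorem exists_taylorWeight_le (hψ : Continuous ψ) (R : ℝ) :
    ∃ M, 0 ≤ M ∧ ∀ p q, |p| ≤ R → |q| ≤ R → taylorWeight ψ p q ≤ M := by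
  obtain ⟨M, hM⟩ := ((isCompact_Icc (a := -R) (b := R)).prod
    (isCompact_Icc (a := -R) (b := R))).exists_bound_of_continuousOn
    (continuous_taylorWeight hψ).continuousOn
  refine ⟨|M|, abs_nonneg _, fun p q hp hq => ?_⟩
  have := hM (p, q) ⟨abs_le.1 hp, abs_le.1 hq⟩
  exact (le_abs_self _).trans (this.trans (le_abs_self M))

end Potential

/-- Extended evenly, a `C²` function on the half-line that vanishes to first order at the end point
is the potential of its (even) second derivative. -/
theorem eq_potential_of_contDiffOn {f : ℝ → ℝ} (hfC2 : ContDiffOn ℝ 2 f (Ici 0)) (hf0 : f 0 = 0)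
    (hf'0 : derivWithin f (Ici 0) 0 = 0) :
    Continuous (fun t => iteratedDerivWithin 2 f (Ici 0) |t|) ∧
      ∀ t, f |t| = potential (fun t => iteratedDerivWithin 2 f (Ici 0) |t|) t := by
  set ψ : ℝ → ℝ := fun t => iteratedDerivWithin 2 f (Ici 0) |t| with hψd
  have hu : UniqueDiffOn ℝ (Ici (0 : ℝ)) := uniqueDiffOn_Ici 0
  have h2 : ContinuousOn (iteratedDerivWithin 2 f (Ici 0)) (Ici 0) :=
    hfC2.continuousOn_iteratedDerivWithin le_rfl hu
  have hψ : Continuous ψ := h2.comp_continuous continuous_abs fun x => abs_nonneg x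
  have hd1 : ContDiffOn ℝ 1 (derivWithin f (Ici 0)) (Ici 0) :=
    hfC2.derivWithin hu (by norm_num)
  have hψ2 : ∀ t, 0 ≤ t → ψ t = derivWithin (derivWithin f (Ici 0)) (Ici 0) t := by
    intro t ht
    simp only [hψd, abs_of_nonneg ht]
    rw [iteratedDerivWithin_succ, iteratedDerivWithin_one]
  -- two functions on the half-line with the same derivative and the same value at `0` agree
  have key : ∀ (g G G' : ℝ → ℝ), DifferentiableOn ℝ g (Ici 0) → g 0 = G 0 →
      (∀ t, HasDerivAt G (G' t) t) → (∀ t, 0 ≤ t → derivWithin g (Ici 0) t = G' t) →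
      ∀ t, 0 ≤ t → g t = G t := by
    intro g G G' hg h0 hG h t ht
    have := (convex_Ici (0 : ℝ)).is_const_of_fderivWithin_eq_zero (𝕜 := ℝ) (f := g - G)
      (hg.sub fun s _ => (hG s).differentiableAt.differentiableWithinAt) ?_ ht
      (show (0 : ℝ) ∈ Ici (0 : ℝ) by simp)
    · simp only [Pi.sub_apply] at this
      linarith
    · intro s hs
      have h1 : HasDerivWithinAt g (G' s) (Ici 0) s := h s hs ▸ (hg s hs).hasDerivWithinAt
      have h3 := (h1.sub (hG s).hasDerivWithinAt)
      rw [sub_self] at h3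
      have h4 := h3.hasFDerivWithinAt.fderivWithin (hu s hs)
      rw [h4]
      ext
      simp
  have hs : ∀ t, 0 ≤ t → derivWithin f (Ici 0) t = slope₀ ψ t :=
    key _ _ _ (hd1.differentiableOn (by norm_num)) (by simp [hf'0, slope₀])
      (hasDerivAt_slope₀ hψ) fun t ht => (hψ2 t ht).symm
  have hp : ∀ t, 0 ≤ t → f t = potential ψ t :=
    key _ _ _ (hfC2.differentiableOn (by norm_num)) (by simp [hf0, potential])
      (hasDerivAt_potential hψ) hs
  have hψe : ∀ t, ψ (-t) = ψ t := fun t => by simp [hψd]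
  have hso : ∀ t, slope₀ ψ (-t) = -slope₀ ψ t := by
    intro t
    have := intervalIntegral.integral_comp_neg (a := 0) (b := t) ψ
    simp only [hψe, neg_zero] at this
    rw [slope₀, intervalIntegral.integral_symm, ← this, slope₀]
  have hpe : ∀ t, potential ψ (-t) = potential ψ t := by
    intro t
    have := intervalIntegral.integral_comp_neg (a := 0) (b := t) (slope₀ ψ)
    simp only [hso, neg_zero, intervalIntegral.integral_neg] at this
    rw [potential, intervalIntegral.integral_symm, ← this, neg_neg, potential]
  refine ⟨hψ, fun t => ?_⟩
  rw [hp _ (abs_nonneg t)]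
  rcases abs_choice t with h | h <;> rw [h]
  exact hpe t

/-! ### Translations and moving averages on `L²(ℝ)` -/

/-- The shift `x ↦ v (x + s)` of `v ∈ L²(ℝ)`. -/
noncomputable def shift (s : ℝ) (v : L2R) : L2R :=
  Lp.compMeasurePreserving (· + s) (measurePreserving_add_right volume s) v

/-- The moving average `∫₀¹ v (· + τ s) dτ` as a Bochner integral in `L²(ℝ)`. -/
noncomputable def movingAverage (s : ℝ) (v : L2R) : L2R :=
  ∫ τ in (0 : ℝ)..1, shift (τ * s) v

/-- The moving average `∫₀¹ v (x + τ s) dτ` at the point `x`. -/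
noncomputable def pointAverage (v : ℝ → ℝ) (s x : ℝ) : ℝ := ∫ τ in (0 : ℝ)..1, v (x + τ * s)

theorem shift_ae (s : ℝ) (v : L2R) : shift s v =ᵐ[volume] fun x => v (x + s) :=
  Lp.coeFn_compMeasurePreserving v (measurePreserving_add_right volume s)

theorem norm_shift (s : ℝ) (v : L2R) : ‖shift s v‖ = ‖v‖ :=
  Lp.norm_compMeasurePreserving v (measurePreserving_add_right volume s)

theorem shift_zero (v : L2R) : shift 0 v = v := by
  ext1
  filter_upwards [shift_ae 0 v] with x hx
  simp [hx]

theorem continuous_shift : Continuous fun p : ℝ × L2R => shift p.1 p.2 := by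
  have hg : Continuous fun p : ℝ × L2R => (⟨fun x : ℝ => x + p.1, by fun_prop⟩ : C(ℝ, ℝ)) :=
    ContinuousMap.continuous_of_continuous_uncurry _ (by
      simp only [Function.uncurry_def, ContinuousMap.coe_mk]; fun_prop)
  exact continuous_snd.compMeasurePreservingLp hg
    (fun p => measurePreserving_add_right volume p.1) (by simp)

theorem inner_eq_integral (v w : L2R) : inner ℝ v w = ∫ x, v x * w x := by
  rw [L2.inner_def]
  simp [mul_comm]

theorem inner_shift (s : ℝ) (v w : L2R) :
    inner ℝ (shift s v) w = inner ℝ v (shift (-s) w) := by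
  rw [inner_eq_integral, inner_eq_integral]
  have h1 : ∫ x, shift s v x * w x = ∫ x, v (x + s) * w x := by
    refine integral_congr_ae ?_
    filter_upwards [shift_ae s v] with x hx
    rw [hx]
  have h2 : ∫ x, v x * shift (-s) w x = ∫ x, v x * w (x + -s) := by
    refine integral_congr_ae ?_
    filter_upwards [shift_ae (-s) w] with x hx
    rw [hx]
  rw [h1, h2, ← integral_add_right_eq_self (fun x => v x * w (x + -s)) s]
  simp

theorem continuous_movingAverage : Continuous fun p : ℝ × L2R => movingAverage p.1 p.2 := by
  refine intervalIntegral.continuous_parametric_intervalIntegral_of_continuous' (μ := volume)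
    (f := fun (p : ℝ × L2R) τ => shift (τ * p.1) p.2) ?_ 0 1
  exact continuous_shift.comp (by fun_prop :
    Continuous fun q : (ℝ × L2R) × ℝ => (q.2 * q.1.1, q.1.2))

theorem continuous_shift_mul (s : ℝ) (v : L2R) : Continuous fun τ => shift (τ * s) v :=
  continuous_shift.comp (by fun_prop : Continuous fun τ : ℝ => (τ * s, v))

theorem movingAverage_zero (v : L2R) : movingAverage 0 v = v := by
  simp [movingAverage, shift_zero]

theorem norm_movingAverage_le (s : ℝ) (v : L2R) : ‖movingAverage s v‖ ≤ ‖v‖ := by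
  have := intervalIntegral.norm_integral_le_of_norm_le_const (a := 0) (b := 1)
    (f := fun τ => shift (τ * s) v) (C := ‖v‖) fun τ _ => (norm_shift _ _).le
  simpa [movingAverage] using this

theorem inner_movingAverage_left (s : ℝ) (v w : L2R) :
    inner ℝ (movingAverage s v) w = ∫ τ in (0 : ℝ)..1, inner ℝ (shift (τ * s) v) w := by
  have := (innerSL ℝ w).intervalIntegral_comp_comm
    ((continuous_shift_mul s v).intervalIntegrable (μ := volume) 0 1)
  rw [real_inner_comm]
  simp only [innerSL_apply_apply] at this
  rw [movingAverage, ← this]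
  simp only [real_inner_comm]

/-- The moving averages with steps `s` and `-s` are adjoint to each other. -/
theorem inner_movingAverage (s : ℝ) (v w : L2R) :
    inner ℝ (movingAverage s v) w = inner ℝ v (movingAverage (-s) w) := by
  rw [inner_movingAverage_left, ← real_inner_comm v, inner_movingAverage_left]
  refine intervalIntegral.integral_congr fun τ _ => ?_
  rw [inner_shift, ← mul_neg, real_inner_comm]

/-- Averaging over translations does not change an integral. -/
theorem lintegral_lintegral_shift {F : ℝ → ENNReal} (hF : Measurable F) (s : ℝ) :
    ∫⁻ x, ∫⁻ τ in Ioc (0 : ℝ) 1, F (x + τ * s) = ∫⁻ x, F x := by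
  rw [lintegral_lintegral_swap (by fun_prop)]
  simp [lintegral_add_right_eq_self F]

theorem Lp_measurable (v : L2R) : Measurable (v : ℝ → ℝ) := (Lp.stronglyMeasurable v).measurable

theorem ae_ae_shift {p : ℝ → Prop} (hp : ∀ᵐ x, p x) (s : ℝ) :
    ∀ᵐ x, ∀ᵐ τ ∂(volume.restrict (Ioc (0 : ℝ) 1)), p (x + τ * s) := by
  set N := toMeasurable volume {x | ¬ p x} with hN
  have hNm : MeasurableSet N := measurableSet_toMeasurable _ _
  have hF : Measurable (N.indicator (1 : ℝ → ENNReal)) := measurable_one.indicator hNm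
  have h := lintegral_lintegral_shift hF s
  rw [lintegral_indicator_one hNm, measure_toMeasurable, ae_iff.1 hp,
    lintegral_eq_zero_iff (Measurable.lintegral_prod_right (by fun_prop))] at h
  filter_upwards [h] with x hx
  rw [Pi.zero_apply, lintegral_eq_zero_iff (by fun_prop)] at hx
  filter_upwards [hx] with τ hτ
  by_contra hne
  have : x + τ * s ∈ N := subset_toMeasurable _ _ hne
  simp [this] at hτ

theorem integrable_shift_prod {F : ℝ → ℝ} (hF : Measurable F) (hi : Integrable F) (s : ℝ) :
    Integrable (fun p : ℝ × ℝ => F (p.1 + p.2 * s))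
      (volume.prod (volume.restrict (Ioc (0 : ℝ) 1))) := by
  refine ⟨Measurable.aestronglyMeasurable (by fun_prop), ?_⟩
  rw [HasFiniteIntegral, lintegral_prod _ (by fun_prop)]
  have := lintegral_lintegral_shift (F := fun x => ‖F x‖ₑ) (by fun_prop) s
  simp only at this ⊢
  rw [this]
  exact hi.2

theorem Lp_integrable_sq (v : L2R) : Integrable fun x => v x ^ 2 := (Lp.memLp v).integrable_sq

/-- The Cauchy-Schwarz inequality on a probability space. -/
theorem sq_integral_le {α : Type*} [MeasurableSpace α] {μ : Measure α} [IsProbabilityMeasure μ]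
    {g : α → ℝ} (hg : Integrable g μ) (hg2 : Integrable (fun x => g x ^ 2) μ) :
    (∫ x, g x ∂μ) ^ 2 ≤ ∫ x, g x ^ 2 ∂μ := by
  set m := ∫ x, g x ∂μ with hm
  have h0 : 0 ≤ ∫ x, (g x ^ 2 - (2 * m) * g x + m ^ 2) ∂μ := by
    refine integral_nonneg fun x => ?_
    simp only [Pi.zero_apply]
    nlinarith [sq_nonneg (g x - m)]
  rw [integral_add (f := fun x => g x ^ 2 - 2 * m * g x) (hg2.sub (hg.const_mul _))
      (integrable_const _),
    integral_sub hg2 (hg.const_mul _), integral_const_mul, ← hm] at h0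
  simp only [integral_const, probReal_univ, one_smul] at h0
  nlinarith

instance : IsProbabilityMeasure (volume.restrict (Ioc (0 : ℝ) 1)) := ⟨by simp⟩

theorem pointAverage_eq (v : ℝ → ℝ) (s x : ℝ) :
    pointAverage v s x = ∫ τ in Ioc (0 : ℝ) 1, v (x + τ * s) :=
  intervalIntegral.integral_of_le zero_le_one

theorem measurable_pointAverage {v : ℝ → ℝ} (hv : Measurable v) :
    Measurable fun p : ℝ × ℝ => pointAverage v p.1 p.2 := by
  simp only [pointAverage_eq]
  exact (StronglyMeasurable.integral_prod_right'
    (f := fun q : (ℝ × ℝ) × ℝ => v (q.1.2 + q.2 * q.1.1))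
    (Measurable.stronglyMeasurable (by fun_prop))).measurable

theorem integrableOn_Ioc_of_sq {g : ℝ → ℝ} (hg : Measurable g)
    (h : IntegrableOn (fun x => g x ^ 2) (Ioc (0 : ℝ) 1)) : IntegrableOn g (Ioc (0 : ℝ) 1) :=
  ((memLp_two_iff_integrable_sq hg.aestronglyMeasurable).2 h).integrable (by norm_num)

theorem memLp_pointAverage (v : L2R) (s : ℝ) : MemLp (pointAverage v s) 2 := by
  have hv := Lp_measurable v
  have hm : Measurable (pointAverage v s) :=
    (measurable_pointAverage hv).comp (by fun_prop : Measurable fun x : ℝ => (s, x))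
  rw [memLp_two_iff_integrable_sq hm.aestronglyMeasurable]
  have hi := integrable_shift_prod (F := fun x => v x ^ 2) (by fun_prop) (Lp_integrable_sq v) s
  refine hi.integral_prod_left.mono' (by fun_prop) ?_
  filter_upwards [hi.prod_right_ae] with x hx
  rw [Real.norm_of_nonneg (sq_nonneg _), pointAverage_eq]
  exact sq_integral_le (integrableOn_Ioc_of_sq (by fun_prop) hx) hx

/-- The Bochner integral that defines the moving average is computed pointwise. -/
theorem movingAverage_ae (v : L2R) (s : ℝ) :
    movingAverage s v =ᵐ[volume] pointAverage v s := by
  have hv := Lp_measurable v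
  set P : L2R := (memLp_pointAverage v s).toLp with hP
  have hPae : P =ᵐ[volume] pointAverage v s := MemLp.coeFn_toLp _
  suffices h : movingAverage s v = P by rw [h]; exact hPae
  refine ext_inner_right ℝ fun w => ?_
  have hw := Lp_measurable w
  have hi1 := integrable_shift_prod (F := fun x => v x ^ 2) (by fun_prop)
    (Lp_integrable_sq v) s
  have hi2 : Integrable (fun p : ℝ × ℝ => w p.1 ^ 2)
      (volume.prod (volume.restrict (Ioc (0 : ℝ) 1))) := by
    simpa using integrable_shift_prod (F := fun x => w x ^ 2) (by fun_prop)
      (Lp_integrable_sq w) 0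
  have hi : Integrable (fun p : ℝ × ℝ => v (p.1 + p.2 * s) * w p.1)
      (volume.prod (volume.restrict (Ioc (0 : ℝ) 1))) := by
    refine (hi1.add hi2).mono' (Measurable.aestronglyMeasurable (by fun_prop))
      (Eventually.of_forall fun p => ?_)
    rw [Real.norm_eq_abs, abs_le]
    simp only [Pi.add_apply]
    constructor <;> nlinarith [sq_nonneg (v (p.1 + p.2 * s) + w p.1),
      sq_nonneg (v (p.1 + p.2 * s) - w p.1), sq_nonneg (v (p.1 + p.2 * s)), sq_nonneg (w p.1)]
  rw [inner_movingAverage_left, intervalIntegral.integral_of_le zero_le_one, inner_eq_integral]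
  have h1 : ∀ τ : ℝ, inner ℝ (shift (τ * s) v) w = ∫ x, v (x + τ * s) * w x := by
    intro τ
    rw [inner_eq_integral]
    refine integral_congr_ae ?_
    filter_upwards [shift_ae (τ * s) v] with x hx
    rw [hx]
  simp only [h1]
  rw [← integral_integral_swap (f := fun x τ => v (x + τ * s) * w x) hi]
  refine integral_congr_ae ?_
  filter_upwards [hPae] with x hx
  rw [hx, pointAverage_eq, integral_mul_const]

/-! ### Weak derivatives -/

/-- A test function as an element of `L²(ℝ)`. -/
noncomputable def testLp (φ : ℝ → ℝ) (hφ : ContDiff ℝ ∞ φ) (hc : HasCompactSupport φ) : L2R :=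
  (hφ.continuous.memLp_of_hasCompactSupport hc).toLp

theorem testLp_ae (φ : ℝ → ℝ) (hφ : ContDiff ℝ ∞ φ) (hc : HasCompactSupport φ) :
    testLp φ hφ hc =ᵐ[volume] φ := MemLp.coeFn_toLp _

theorem inner_testLp (w : L2R) (φ : ℝ → ℝ) (hφ : ContDiff ℝ ∞ φ) (hc : HasCompactSupport φ) :
    inner ℝ w (testLp φ hφ hc) = ∫ x, w x * φ x := by
  rw [inner_eq_integral]
  refine integral_congr_ae ?_
  filter_upwards [testLp_ae φ hφ hc] with x hx
  rw [hx]

theorem contDiff_deriv_test {φ : ℝ → ℝ} (hφ : ContDiff ℝ ∞ φ) : ContDiff ℝ ∞ (deriv φ) :=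
  (contDiff_infty_iff_deriv.1 hφ).2

theorem isWeakDeriv_iff_inner (u v : L2R) : IsWeakDeriv u v ↔
    ∀ (φ : ℝ → ℝ) (hφ : ContDiff ℝ ∞ φ) (hc : HasCompactSupport φ),
      inner ℝ u (testLp (deriv φ) (contDiff_deriv_test hφ) hc.deriv) =
        - inner ℝ v (testLp φ hφ hc) := by
  simp only [inner_testLp]
  rfl

/-- Test functions separate the points of `L²(ℝ)`. -/
theorem eq_of_inner_testLp {v w : L2R}
    (h : ∀ (φ : ℝ → ℝ) (hφ : ContDiff ℝ ∞ φ) (hc : HasCompactSupport φ),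
      inner ℝ v (testLp φ hφ hc) = inner ℝ w (testLp φ hφ hc)) : v = w := by
  ext1
  refine ae_eq_of_integral_contDiff_smul_eq ((Lp.memLp v).locallyIntegrable (by norm_num))
    ((Lp.memLp w).locallyIntegrable (by norm_num)) fun φ hφ hc => ?_
  simpa [inner_testLp, mul_comm] using h φ hφ hc

theorem IsWeakDeriv.unique {u v w : L2R} (hv : IsWeakDeriv u v) (hw : IsWeakDeriv u w) :
    v = w := by
  rw [isWeakDeriv_iff_inner] at hv hw
  refine eq_of_inner_testLp fun φ hφ hc => ?_
  have := (hv φ hφ hc).symm.trans (hw φ hφ hc)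
  linarith

theorem isWeakDeriv_testLp (φ : ℝ → ℝ) (hφ : ContDiff ℝ ∞ φ) (hc : HasCompactSupport φ) :
    IsWeakDeriv (testLp φ hφ hc) (testLp (deriv φ) (contDiff_deriv_test hφ) hc.deriv) := by
  intro χ hχ hχc
  have hd := contDiff_deriv_test hφ
  have hdχ := contDiff_deriv_test hχ
  have e1 : ∫ x, testLp φ hφ hc x * deriv χ x = ∫ x, φ x * deriv χ x := by
    refine integral_congr_ae ?_
    filter_upwards [testLp_ae φ hφ hc] with x hx
    rw [hx]
  have e2 : ∫ x, testLp (deriv φ) hd hc.deriv x * χ x = ∫ x, deriv φ x * χ x := by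
    refine integral_congr_ae ?_
    filter_upwards [testLp_ae (deriv φ) hd hc.deriv] with x hx
    rw [hx]
  rw [e1, e2]
  refine integral_mul_deriv_eq_deriv_mul_of_integrable
    (fun x _ => (hφ.differentiable (by simp) x).hasDerivAt)
    (fun x _ => (hχ.differentiable (by simp) x).hasDerivAt) ?_ ?_ ?_
  · exact (hφ.continuous.mul hdχ.continuous).integrable_of_hasCompactSupport hc.mul_right
  · exact (hd.continuous.mul hχ.continuous).integrable_of_hasCompactSupport hχc.mul_left
  · exact (hφ.continuous.mul hχ.continuous).integrable_of_hasCompactSupport hc.mul_right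

/-- The fundamental theorem of calculus for weak derivatives. It is the definition of the weak
derivative, tested with the primitive of `φ (· - s) - φ`. -/
theorem IsWeakDeriv.shift_sub_self {u v : L2R} (h : IsWeakDeriv u v) (s : ℝ) :
    shift s u - u = s • movingAverage s v := by
  refine eq_of_inner_testLp fun φ hφ hc => ?_
  set P : ℝ → ℝ := fun x => ∫ y in (0 : ℝ)..x, φ y with hP
  have hPd : ∀ x, HasDerivAt P (φ x) x := fun x => hasDerivAt_slope₀ hφ.continuous x
  have hPs : ContDiff ℝ ∞ P := by
    rw [contDiff_infty_iff_deriv]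
    refine ⟨fun x => (hPd x).differentiableAt, ?_⟩
    rwa [show deriv P = φ from funext fun x => (hPd x).deriv]
  set η : ℝ → ℝ := fun x => P (x - s) - P x with hη
  have hηs : ContDiff ℝ ∞ η := by
    refine (hPs.comp (contDiff_id.sub contDiff_const)).sub hPs
  have hηd : deriv η = fun x => φ (x - s) - φ x := by
    funext x
    exact (((hPd (x - s)).comp_sub_const x s).sub (hPd x)).deriv
  have hηint : ∀ x, η x = -s * pointAverage φ (-s) x := by
    intro x
    have h1 := intervalIntegral.smul_integral_comp_add_mul (a := 0) (b := 1) φ (-s) x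
    rw [smul_eq_mul] at h1
    have h2 : pointAverage φ (-s) x = ∫ y in (0 : ℝ)..1, φ (x + -s * y) := by
      simp only [pointAverage, mul_comm]
    rw [h2, h1, hη]
    simp only [hP]
    rw [intervalIntegral.integral_interval_sub_left (hφ.continuous.intervalIntegrable _ _)
      (hφ.continuous.intervalIntegrable _ _)]
    congr 1 <;> ring
  -- `η` vanishes at distance `|s|` from a ball that contains the support of `φ`
  obtain ⟨R, hR⟩ := hc.isCompact.isBounded.subset_closedBall 0
  have hηc : HasCompactSupport η := by
    refine HasCompactSupport.intro (isCompact_closedBall 0 (R + |s|)) fun x hx => ?_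
    rw [hηint, pointAverage, intervalIntegral.integral_zero_ae, mul_zero]
    refine Eventually.of_forall fun τ hτ => ?_
    rw [uIoc_of_le zero_le_one] at hτ
    by_contra hne
    have h1 := hR (subset_tsupport _ hne)
    apply hx
    rw [mem_closedBall_zero_iff, Real.norm_eq_abs] at h1 ⊢
    have h2 : |τ * s| ≤ |s| := by
      rw [abs_mul, abs_of_pos hτ.1]
      exact mul_le_of_le_one_left (abs_nonneg _) hτ.2
    have h3 : x = (x + τ * -s) + τ * s := by ring
    calc |x| = |(x + τ * -s) + τ * s| := by rw [← h3]
      _ ≤ |x + τ * -s| + |τ * s| := abs_add_le _ _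
      _ ≤ R + |s| := add_le_add h1 h2
  have hφt := testLp_ae φ hφ hc
  have hmain := h η hηs hηc
  have e1 : ∫ x, u x * deriv η x =
      inner ℝ u (shift (-s) (testLp φ hφ hc) - testLp φ hφ hc) := by
    rw [inner_eq_integral]
    refine integral_congr_ae ?_
    have hq := (measurePreserving_add_right volume (-s)).quasiMeasurePreserving.ae_eq_comp hφt
    filter_upwards [Lp.coeFn_sub (shift (-s) (testLp φ hφ hc)) (testLp φ hφ hc),
      shift_ae (-s) (testLp φ hφ hc), hφt, hq] with x h1 h2 h3 h4
    simp only [Function.comp] at h4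
    rw [h1, Pi.sub_apply, h2, h3, h4, hηd]
    rfl
  have e2 : ∫ x, v x * η x = -s * inner ℝ v (movingAverage (-s) (testLp φ hφ hc)) := by
    rw [inner_eq_integral, ← integral_const_mul]
    refine integral_congr_ae ?_
    filter_upwards [movingAverage_ae (testLp φ hφ hc) (-s), ae_ae_shift hφt (-s)] with x h1 h2
    rw [h1, hηint, pointAverage_eq, pointAverage_eq, integral_congr_ae h2]
    ring
  rw [e1, e2, inner_sub_right, ← inner_shift, ← inner_movingAverage] at hmain
  rw [inner_sub_left, hmain, inner_smul_left]
  simp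

/-- The quotient of `v (· + t s) - ∫₀¹ v (· + τ s) dτ` by `s`, expressed through the weak derivative
`w` of `v`; see `IsWeakDeriv.shift_sub_movingAverage`. -/
noncomputable def drift (t s : ℝ) (w : L2R) : L2R :=
  t • movingAverage (t * s) w - ∫ τ in (0 : ℝ)..1, τ • movingAverage (τ * s) w

theorem continuous_movingAverage_comp {X : Type*} [TopologicalSpace X] {f : X → ℝ}
    (hf : Continuous f) (w : L2R) : Continuous fun x => movingAverage (f x) w :=
  continuous_movingAverage.comp (hf.prodMk continuous_const)

theorem IsWeakDeriv.shift_sub_movingAverage {v w : L2R} (h : IsWeakDeriv v w) (t s : ℝ) :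
    shift (t * s) v - movingAverage s v = s • drift t s w := by
  have hc : Continuous fun τ => τ • movingAverage (τ * s) w :=
    continuous_id.smul (continuous_movingAverage_comp (continuous_id.mul continuous_const) w)
  have e : ∀ τ, shift (τ * s) v = v + s • (τ • movingAverage (τ * s) w) := by
    intro τ
    rw [smul_smul, mul_comm s, ← h.shift_sub_self]
    abel
  have e2 : movingAverage s v = v + s • ∫ τ in (0 : ℝ)..1, τ • movingAverage (τ * s) w := by
    rw [movingAverage]
    simp only [e]
    rw [intervalIntegral.integral_add (f := fun _ => v)
      (g := fun τ => s • (τ • movingAverage (τ * s) w)) intervalIntegrable_const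
      ((hc.const_smul s).intervalIntegrable _ _), intervalIntegral.integral_smul]
    simp
  rw [e, e2, drift, smul_sub]
  abel

/-- In the limit `s → 0` the drift is `t - ∫₀¹ τ dτ` times the weak derivative. -/
theorem tendsto_drift (t : ℝ) (w : L2R) :
    Tendsto (fun s => drift t s w) (𝓝 0) (𝓝 ((t - 1 / 2) • w)) := by
  have hc : Continuous fun s => drift t s w := by
    refine Continuous.sub ((continuous_movingAverage_comp
      (continuous_const.mul continuous_id) w).const_smul t) ?_
    refine intervalIntegral.continuous_parametric_intervalIntegral_of_continuous' (μ := volume)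
      (f := fun (s : ℝ) τ => τ • movingAverage (τ * s) w) ?_ 0 1
    exact continuous_snd.smul (continuous_movingAverage_comp
      (continuous_snd.mul continuous_fst) w)
  have := hc.tendsto 0
  simp only [drift, mul_zero, movingAverage_zero, intervalIntegral.integral_smul_const] at this
  rw [← sub_smul] at this
  simpa [drift] using this

theorem norm_drift_le {t : ℝ} (ht : t ∈ Icc (0 : ℝ) 1) (s : ℝ) (w : L2R) :
    ‖drift t s w‖ ≤ 2 * ‖w‖ := by
  have h : ∀ τ ∈ Icc (0 : ℝ) 1, ‖τ • movingAverage (τ * s) w‖ ≤ ‖w‖ := by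
    intro τ hτ
    rw [norm_smul, Real.norm_of_nonneg hτ.1]
    exact (mul_le_of_le_one_left (norm_nonneg _) hτ.2).trans (norm_movingAverage_le _ _)
  have h2 := intervalIntegral.norm_integral_le_of_norm_le_const (a := 0) (b := 1)
    (f := fun τ => τ • movingAverage (τ * s) w) (C := ‖w‖) fun τ hτ => by
      rw [uIoc_of_le zero_le_one] at hτ
      exact h τ (Ioc_subset_Icc_self hτ)
  simp only [sub_zero, abs_one, mul_one] at h2
  exact (norm_sub_le _ _).trans (by linarith [h t ht])

/-- Shifted functions minus their averages have an adjoint of the same form. -/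
theorem inner_shift_sub_movingAverage (t s : ℝ) (v w : L2R) :
    inner ℝ (shift (t * s) v - movingAverage s v) w =
      inner ℝ v (shift (t * -s) w - movingAverage (-s) w) := by
  rw [inner_sub_left, inner_sub_right, inner_shift, inner_movingAverage, mul_neg]

/-! ### Jensen gaps of averages over segments -/

/-- The integral over `x` of the Bregman distance between the mean of `v` over the segment from `x`
to `x + s` and the value `v (x + τ s)`. -/
noncomputable def gap (ψ v : ℝ → ℝ) (s τ : ℝ) : ENNReal :=
  ∫⁻ x, ENNReal.ofReal (bregman ψ (pointAverage v s x) (v (x + τ * s)))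

section Gap

variable {ψ : ℝ → ℝ} {γ : ℝ}

theorem measurable_potential (hψ : Continuous ψ) : Measurable (potential ψ) :=
  (continuous_potential hψ).measurable

theorem measurable_ofReal_bregman (hψ : Continuous ψ) {α : Type*} [MeasurableSpace α]
    {f g : α → ℝ} (hf : Measurable f) (hg : Measurable g) :
    Measurable fun a => ENNReal.ofReal (bregman ψ (f a) (g a)) :=
  ENNReal.measurable_ofReal.comp ((continuous_bregman hψ).measurable.comp (hf.prodMk hg))

theorem measurable_ofReal_potential (hψ : Continuous ψ) {α : Type*} [MeasurableSpace α]
    {f : α → ℝ} (hf : Measurable f) : Measurable fun a => ENNReal.ofReal (potential ψ (f a)) :=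
  ENNReal.measurable_ofReal.comp ((measurable_potential hψ).comp hf)

theorem measurable_pointAverage_comp {v : ℝ → ℝ} (hv : Measurable v) {α : Type*}
    [MeasurableSpace α] {f g : α → ℝ} (hf : Measurable f) (hg : Measurable g) :
    Measurable fun a => pointAverage v (f a) (g a) :=
  (measurable_pointAverage hv).comp (hf.prodMk hg)

theorem measurable_bregman_average (hψ : Continuous ψ) {v : ℝ → ℝ} (hv : Measurable v)
    {α : Type*} [MeasurableSpace α] {f g k : α → ℝ} (hf : Measurable f) (hg : Measurable g)
    (hk : Measurable k) :
    Measurable fun a => ENNReal.ofReal (bregman ψ (pointAverage v (f a) (k a))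
      (v (k a + g a * f a))) :=
  measurable_ofReal_bregman hψ (measurable_pointAverage_comp hv hf hk)
    (hv.comp (hk.add (hg.mul hf)))

theorem measurable_gap (hψ : Continuous ψ) {v : ℝ → ℝ} (hv : Measurable v) {α : Type*}
    [MeasurableSpace α] {f g : α → ℝ} (hf : Measurable f) (hg : Measurable g) :
    Measurable fun a => gap ψ v (f a) (g a) :=
  (measurable_bregman_average hψ hv (hf.comp measurable_fst) (hg.comp measurable_fst)
    measurable_snd).lintegral_prod_right'

/-- Jensen's inequality with its defect, the mean Bregman distance from the mean. -/
theorem lintegral_bregman_add {α : Type*} [MeasurableSpace α] {μ : Measure α}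
    [IsProbabilityMeasure μ] (hψ : Continuous ψ) (hγ0 : 0 < γ) (hγ : ∀ t, γ ≤ ψ t) {g : α → ℝ}
    (hg : Integrable g μ) (hpg : Integrable (fun x => potential ψ (g x)) μ) :
    ∫⁻ x, ENNReal.ofReal (bregman ψ (∫ y, g y ∂μ) (g x)) ∂μ
        + ENNReal.ofReal (potential ψ (∫ y, g y ∂μ))
      = ∫⁻ x, ENNReal.ofReal (potential ψ (g x)) ∂μ := by
  generalize hmd : ∫ y, g y ∂μ = m
  have hb : ∀ x, bregman ψ m (g x) = potential ψ (g x) -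
      (potential ψ m + slope₀ ψ m * (g x - m)) := by
    intro x
    rw [potential_eq_add_bregman hψ m (g x)]
    ring
  have hi3 : Integrable (fun x => slope₀ ψ m * (g x - m)) μ :=
    (hg.sub (integrable_const m)).const_mul _
  have hi2 : Integrable (fun x => potential ψ m + slope₀ ψ m * (g x - m)) μ :=
    (integrable_const _).add hi3
  have hbi : Integrable (fun x => bregman ψ m (g x)) μ := by
    simp only [hb]
    exact hpg.sub hi2
  have hb0 : ∀ x, 0 ≤ bregman ψ m (g x) := fun x => bregman_nonneg hψ hγ0 hγ _ _
  rw [← ofReal_integral_eq_lintegral_ofReal hbi (Eventually.of_forall hb0),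
    ← ofReal_integral_eq_lintegral_ofReal hpg
      (Eventually.of_forall fun x => potential_nonneg hψ hγ0 hγ _),
    ← ENNReal.ofReal_add (integral_nonneg hb0) (potential_nonneg hψ hγ0 hγ _)]
  congr 1
  simp only [hb]
  rw [integral_sub hpg hi2, integral_add (integrable_const _) hi3, integral_const_mul,
    integral_sub hg (integrable_const m), hmd]
  simp

/-- Averaging `v` over segments of length `s` lowers the integral of the potential by the mean
Bregman distance. -/
theorem lintegral_gap_add (hψ : Continuous ψ) (hγ0 : 0 < γ) (hγ : ∀ t, γ ≤ ψ t)
    {v : ℝ → ℝ} (hv : Measurable v) (hv2 : Integrable fun x => v x ^ 2)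
    (hfin : ∫⁻ x, ENNReal.ofReal (potential ψ (v x)) ≠ ⊤) (s : ℝ) :
    (∫⁻ τ in Ioc (0 : ℝ) 1, gap ψ v s τ) + ∫⁻ x, ENNReal.ofReal (potential ψ (pointAverage v s x))
      = ∫⁻ x, ENNReal.ofReal (potential ψ (v x)) := by
  have hpv : Measurable fun x => potential ψ (v x) := (measurable_potential hψ).comp hv
  have hpm : Measurable fun x => ENNReal.ofReal (potential ψ (pointAverage v s x)) :=
    measurable_ofReal_potential hψ
      (measurable_pointAverage_comp hv measurable_const measurable_id)
  have hbm : Measurable fun q : ℝ × ℝ =>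
      ENNReal.ofReal (bregman ψ (pointAverage v s q.2) (v (q.2 + q.1 * s))) :=
    measurable_bregman_average hψ hv measurable_const measurable_fst measurable_snd
  have hpi : Integrable fun x => potential ψ (v x) :=
    ⟨hpv.aestronglyMeasurable,
      (hasFiniteIntegral_iff_ofReal (Eventually.of_forall fun x =>
        potential_nonneg hψ hγ0 hγ _)).2 (lt_top_iff_ne_top.2 hfin)⟩
  simp only [gap]
  rw [lintegral_lintegral_swap hbm.aemeasurable, ← lintegral_add_right _ hpm,
    ← lintegral_lintegral_shift (F := fun x => ENNReal.ofReal (potential ψ (v x)))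
      (measurable_ofReal_potential hψ hv) s]
  refine lintegral_congr_ae ?_
  filter_upwards [(integrable_shift_prod hpv hpi s).prod_right_ae,
    (integrable_shift_prod (hv.pow_const 2) hv2 s).prod_right_ae] with x h1 h2
  have h3 : IntegrableOn (fun τ => v (x + τ * s)) (Ioc (0 : ℝ) 1) :=
    integrableOn_Ioc_of_sq (by fun_prop) h2
  rw [pointAverage_eq]
  exact lintegral_bregman_add hψ hγ0 hγ h3 h1

/-- A pointwise bound for averages over segments of nonzero length. -/
theorem abs_pointAverage_le {v : ℝ → ℝ} (hv2 : Integrable fun x => v x ^ 2) {s : ℝ}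
    (hs : s ≠ 0) (x : ℝ) :
    |pointAverage v s x| ≤ 1 + |s⁻¹| * ∫ y, v y ^ 2 := by
  have hi : Integrable fun τ => v (x + τ * s) ^ 2 :=
    ((hv2.comp_add_left x).comp_mul_right' hs)
  have h1 : ∫ τ, v (x + τ * s) ^ 2 = |s⁻¹| * ∫ y, v y ^ 2 := by
    have := Measure.integral_comp_mul_right (fun y => v (x + y) ^ 2) s
    rw [this, integral_add_left_eq_self (fun y => v y ^ 2) x, smul_eq_mul]
  have h2 : ∫ τ in Ioc (0 : ℝ) 1, (1 + v (x + τ * s) ^ 2) ≤ 1 + |s⁻¹| * ∫ y, v y ^ 2 := by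
    rw [integral_add (integrable_const _) hi.integrableOn, ← h1]
    have := setIntegral_le_integral (s := Ioc (0 : ℝ) 1) hi
      (Eventually.of_forall fun τ => sq_nonneg _)
    simpa using this
  rw [pointAverage_eq]
  refine (abs_integral_le_integral_abs).trans (le_trans ?_ h2)
  refine integral_mono_of_nonneg (Eventually.of_forall fun τ => abs_nonneg _)
    ((integrable_const _).add hi.integrableOn) (Eventually.of_forall fun τ => ?_)
  nlinarith [sq_nonneg (|v (x + τ * s)| - 1), sq_abs (v (x + τ * s)), abs_nonneg (v (x + τ * s))]

/-- Averages over segments of nonzero length are bounded, and the potential is quadratic on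
bounded sets. -/
theorem lintegral_potential_pointAverage_ne_top (hψ : Continuous ψ) (v : L2R) {s : ℝ}
    (hs : s ≠ 0) : ∫⁻ x, ENNReal.ofReal (potential ψ (pointAverage v s x)) ≠ ⊤ := by
  obtain ⟨M, hM0, hM⟩ := exists_taylorWeight_le hψ (1 + |s⁻¹| * ∫ y, v y ^ 2)
  have h0 : 0 ≤ 1 + |s⁻¹| * ∫ y, v y ^ 2 :=
    add_nonneg zero_le_one (mul_nonneg (abs_nonneg _) (integral_nonneg fun y => sq_nonneg _))
  have hi : Integrable fun x => M * pointAverage v s x ^ 2 :=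
    (memLp_pointAverage v s).integrable_sq.const_mul M
  have hfin := (hasFiniteIntegral_iff_ofReal (Eventually.of_forall fun x =>
    mul_nonneg hM0 (sq_nonneg (pointAverage v s x)))).1 hi.2
  refine ne_top_of_le_ne_top hfin.ne (lintegral_mono fun x => ENNReal.ofReal_le_ofReal ?_)
  rw [potential_eq_bregman hψ]
  exact mul_le_mul_of_nonneg_right (hM _ _ (by simpa using h0) (abs_pointAverage_le (Lp_integrable_sq v) hs x))
    (sq_nonneg _)

/-- The difference quotients of `u` are averages of the weak derivative. -/
theorem H1.differenceQuotient_ae (u : H1) {z : ℝ} (hz : z ≠ 0) :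
    ∀ᵐ x, (u.fn (x + z) - u.fn x) / z = pointAverage u.weakDeriv z x := by
  have h := IsWeakDeriv.shift_sub_self u.2 z
  have h1 := Lp.coeFn_sub (shift z u.1.fst) u.1.fst
  have h2 := Lp.coeFn_smul z (movingAverage z u.1.snd)
  rw [h] at h1
  filter_upwards [h1, h2, shift_ae z u.1.fst, movingAverage_ae u.1.snd z] with x a1 a2 a3 a4
  rw [div_eq_iff hz, mul_comm]
  simp only [H1.fn, H1.weakDeriv]
  rw [← a4, ← smul_eq_mul, ← Pi.smul_apply, ← a2, a1, Pi.sub_apply, a3]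

theorem H1.measurable_fn (u : H1) : Measurable u.fn := Lp_measurable u.1.fst

theorem H1.measurable_weakDeriv (u : H1) : Measurable u.weakDeriv := Lp_measurable u.1.snd

theorem H1.differenceQuotient_ae_prod (u : H1) :
    ∀ᵐ p : ℝ × ℝ, (u.fn (p.1 + p.2) - u.fn p.1) / p.2 = pointAverage u.weakDeriv p.2 p.1 := by
  have h1 := u.measurable_fn
  have h2 : Measurable fun p : ℝ × ℝ => pointAverage u.weakDeriv p.2 p.1 :=
    (measurable_pointAverage u.measurable_weakDeriv).comp measurable_swap
  have hm : MeasurableSet {p : ℝ × ℝ |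
      (u.fn (p.1 + p.2) - u.fn p.1) / p.2 = pointAverage u.weakDeriv p.2 p.1} :=
    measurableSet_eq_fun (by fun_prop) h2
  rw [Measure.volume_eq_prod, Measure.ae_prod_iff_ae_ae hm, Measure.ae_ae_comm hm]
  filter_upwards [Measure.ae_ne volume 0] with z hz using u.differenceQuotient_ae hz

end Gap

theorem extIntegral_congr_ae {α : Type*} [MeasurableSpace α] {μ : Measure α} {g g' : α → ℝ}
    (h : g =ᵐ[μ] g') : extIntegral μ g = extIntegral μ g' := by
  have h1 : ∫⁻ x, ENNReal.ofReal (g x) ∂μ = ∫⁻ x, ENNReal.ofReal (g' x) ∂μ :=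
    lintegral_congr_ae (h.mono fun x hx => by simp only [hx])
  have h2 : ∫⁻ x, ENNReal.ofReal (-g x) ∂μ = ∫⁻ x, ENNReal.ofReal (-g' x) ∂μ :=
    lintegral_congr_ae (h.mono fun x hx => by simp only [hx])
  rw [extIntegral, extIntegral, h1, h2]

/-- The value `c = +∞` is allowed: then the integral of the positive part is infinite. -/
theorem extIntegral_eq_of_eq_add {α : Type*} [MeasurableSpace α] {μ : Measure α} {g : α → ℝ}
    {c : ENNReal} (hn : ∫⁻ x, ENNReal.ofReal (-g x) ∂μ ≠ ⊤)
    (h : ∫⁻ x, ENNReal.ofReal (g x) ∂μ = ∫⁻ x, ENNReal.ofReal (-g x) ∂μ + c) :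
    extIntegral μ g = c := by
  rw [extIntegral]
  split_ifs with ht
  · rw [ht] at h
    rcases (ENNReal.add_eq_top.1 h.symm) with h' | h'
    · exact absurd h' hn
    · simp [h']
  · rw [h]
    rw [h] at ht
    have hc : c ≠ ⊤ := fun hc => ht (by simp [hc])
    lift c to NNReal using hc
    generalize ∫⁻ x, ENNReal.ofReal (-g x) ∂μ = n at *
    lift n to NNReal using hn
    rw [← ENNReal.coe_add, EReal.coe_nnreal_eq_coe_real, EReal.coe_nnreal_eq_coe_real,
      EReal.coe_nnreal_eq_coe_real, ← EReal.coe_sub]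
    simp

theorem ofReal_sub_add_ofReal {a b : ℝ} (ha : 0 ≤ a) (hb : 0 ≤ b) :
    ENNReal.ofReal (a - b) + ENNReal.ofReal b = ENNReal.ofReal (-(a - b)) + ENNReal.ofReal a := by
  rcases le_total a b with h | h
  · rw [ENNReal.ofReal_of_nonpos (by linarith : a - b ≤ 0),
      ← ENNReal.ofReal_add (by linarith) ha]
    simp
  · rw [ENNReal.ofReal_of_nonpos (by linarith : -(a - b) ≤ 0),
      ← ENNReal.ofReal_add (by linarith) hb]
    simp

/-! ### The value of the rate functional -/

section Rate

variable {ψ f K : ℝ → ℝ} {γ : ℝ}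

theorem aemeasurable_rescaledKernel (hK : AEMeasurable K) {h : ℝ} (hh : 0 < h) :
    AEMeasurable (rescaledKernel K h) := by
  have := hK.comp_quasiMeasurePreserving
    (Measure.quasiMeasurePreserving_smul (volume : Measure ℝ) (inv_ne_zero hh.ne'))
  refine (this.const_mul h⁻¹).congr (Eventually.of_forall fun z => ?_)
  simp [rescaledKernel, div_eq_inv_mul]

theorem rescaledKernel_nonneg (hK0 : ∀ z, 0 ≤ K z) {h : ℝ} (hh : 0 < h) (z : ℝ) :
    0 ≤ rescaledKernel K h z :=
  mul_nonneg (inv_nonneg.2 hh.le) (hK0 _)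

/-- The change of variables `z = h y`. -/
theorem lintegral_rescaledKernel_mul (K : ℝ → ℝ) {h : ℝ} (hh : 0 < h) (F : ℝ → ENNReal) :
    ∫⁻ z, ENNReal.ofReal (rescaledKernel K h z) * F z =
      ∫⁻ y, ENNReal.ofReal (K y) * F (h * y) := by
  have hm : ∀ G : ℝ → ENNReal, ∫⁻ z, G z = ENNReal.ofReal h * ∫⁻ y, G (h * y) := by
    intro G
    conv_lhs => rw [← Real.smul_map_volume_mul_left hh.ne']
    rw [lintegral_smul_measure, (measurableEmbedding_mulLeft₀ hh.ne').lintegral_map,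
      abs_of_pos hh, smul_eq_mul]
  rw [hm, ← lintegral_const_mul' _ _ ENNReal.ofReal_ne_top]
  refine lintegral_congr fun y => ?_
  rw [← mul_assoc, ← ENNReal.ofReal_mul hh.le, rescaledKernel, mul_div_cancel_left₀ _ hh.ne',
    mul_inv_cancel_left₀ hh.ne']

theorem rateFunctional_eq_extIntegral (hf : ∀ t, f |t| = potential ψ t) (K : ℝ → ℝ) (h : ℝ)
    (u : H1) :
    rateFunctional f K h u = ((1 / h ^ 2 : ℝ) : EReal) * extIntegral volume fun p : ℝ × ℝ =>
      rescaledKernel K h p.2 * (potential ψ (u.weakDeriv p.1)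
        - potential ψ (pointAverage u.weakDeriv p.2 p.1)) := by
  rw [rateFunctional]
  congr 1
  refine extIntegral_congr_ae ?_
  filter_upwards [u.differenceQuotient_ae_prod] with p hp
  rw [hf, hf, hp]

theorem aemeasurable_rescaledKernel_mul (hK : AEMeasurable K) {h : ℝ} (hh : 0 < h)
    {g : ℝ × ℝ → ℝ} (hg : Measurable g) :
    AEMeasurable fun p : ℝ × ℝ => ENNReal.ofReal (rescaledKernel K h p.2 * g p) :=
  ENNReal.measurable_ofReal.comp_aemeasurable
    (((aemeasurable_rescaledKernel hK hh).comp_quasiMeasurePreserving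
      Measure.quasiMeasurePreserving_snd).mul hg.aemeasurable)

theorem lintegral_prod_rescaledKernel_mul (hK0 : ∀ z, 0 ≤ K z) (hK : AEMeasurable K) {h : ℝ}
    (hh : 0 < h) {g : ℝ × ℝ → ℝ} (hg : Measurable g) :
    ∫⁻ p : ℝ × ℝ, ENNReal.ofReal (rescaledKernel K h p.2 * g p) =
      ∫⁻ z, ENNReal.ofReal (rescaledKernel K h z) * ∫⁻ x, ENNReal.ofReal (g (x, z)) := by
  have := lintegral_prod_symm _ (aemeasurable_rescaledKernel_mul hK hh hg)
  rw [Measure.volume_eq_prod, this]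
  refine lintegral_congr fun z => ?_
  simp only [ENNReal.ofReal_mul (rescaledKernel_nonneg hK0 hh z)]
  rw [lintegral_const_mul' _ _ ENNReal.ofReal_ne_top]

/-- If the potential of `u'` is not integrable, then the rate functional is infinite: for each
`z ≠ 0` the potential of the difference quotients is integrable. -/
theorem rateFunctional_eq_top (hψ : Continuous ψ) (hγ0 : 0 < γ) (hγ : ∀ t, γ ≤ ψ t)
    (hf : ∀ t, f |t| = potential ψ t) (hK0 : ∀ z, 0 ≤ K z) (hK : AEMeasurable K)
    (hKpos : ¬ ∀ᵐ z, K z = 0) {h : ℝ} (hh : 0 < h) (u : H1)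
    (hu : ∫⁻ x, ENNReal.ofReal (potential ψ (u.weakDeriv x)) = ⊤) :
    rateFunctional f K h u = ⊤ := by
  have hv := u.measurable_weakDeriv
  have hk := aemeasurable_rescaledKernel hK hh
  have hpv : Measurable fun p : ℝ × ℝ => potential ψ (u.weakDeriv p.1) :=
    (measurable_potential hψ).comp (hv.comp measurable_fst)
  have hpm : Measurable fun p : ℝ × ℝ => potential ψ (pointAverage u.weakDeriv p.2 p.1) :=
    (measurable_potential hψ).comp (measurable_pointAverage_comp hv measurable_snd measurable_fst)
  rw [rateFunctional_eq_extIntegral hf]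
  suffices hpos : ∫⁻ p : ℝ × ℝ, ENNReal.ofReal (rescaledKernel K h p.2 *
      (potential ψ (u.weakDeriv p.1) - potential ψ (pointAverage u.weakDeriv p.2 p.1))) = ⊤ by
    rw [extIntegral, if_pos hpos]
    exact EReal.coe_mul_top_of_pos (by positivity)
  refine (lintegral_prod_rescaledKernel_mul hK0 hK hh (hpv.sub hpm)).trans ?_
  have hz : ∀ᵐ z, ENNReal.ofReal (rescaledKernel K h z) * ∫⁻ x, ENNReal.ofReal
      (potential ψ (u.weakDeriv x) - potential ψ (pointAverage u.weakDeriv z x)) =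
      ENNReal.ofReal (rescaledKernel K h z) * ⊤ := by
    filter_upwards [Measure.ae_ne volume 0] with z hz
    congr 1
    have h1 : Measurable fun x => ENNReal.ofReal (potential ψ (pointAverage u.weakDeriv z x)) :=
      measurable_ofReal_potential hψ
        (measurable_pointAverage_comp hv measurable_const measurable_id)
    have h2 : ∫⁻ x, (ENNReal.ofReal (potential ψ (u.weakDeriv x)
        - potential ψ (pointAverage u.weakDeriv z x))
        + ENNReal.ofReal (potential ψ (pointAverage u.weakDeriv z x))) = ⊤ := by
      refine top_le_iff.1 (hu ▸ lintegral_mono fun x => ?_)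
      rw [ofReal_sub_add_ofReal (potential_nonneg hψ hγ0 hγ _) (potential_nonneg hψ hγ0 hγ _)]
      exact le_add_self
    rw [lintegral_add_right _ h1, ENNReal.add_eq_top] at h2
    exact h2.resolve_right (lintegral_potential_pointAverage_ne_top hψ u.1.snd hz)
  simp only [Pi.sub_apply]
  rw [lintegral_congr_ae hz]
  have := lintegral_rescaledKernel_mul K hh fun _ => ⊤
  rw [this, lintegral_mul_const'' _ hK.ennreal_ofReal, ENNReal.mul_top]
  rw [Ne, lintegral_eq_zero_iff' hK.ennreal_ofReal]
  refine fun h0 => hKpos (h0.mono fun z hz => ?_)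
  exact le_antisymm (ENNReal.ofReal_eq_zero.1 hz) (hK0 z)

/-- If the potential of `u'` is integrable, then the rate functional is the integral of the
Jensen gaps of `u'` over segments. -/
theorem rateFunctional_eq_lintegral_gap (hψ : Continuous ψ) (hγ0 : 0 < γ) (hγ : ∀ t, γ ≤ ψ t)
    (hf : ∀ t, f |t| = potential ψ t) (hK0 : ∀ z, 0 ≤ K z) (hKi : Integrable K)
    {h : ℝ} (hh : 0 < h) (u : H1)
    (hu : ∫⁻ x, ENNReal.ofReal (potential ψ (u.weakDeriv x)) ≠ ⊤) :
    rateFunctional f K h u = ((∫⁻ y, ENNReal.ofReal (K y) * ∫⁻ τ in Ioc (0 : ℝ) 1,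
      ENNReal.ofReal (1 / h ^ 2) * gap ψ u.weakDeriv (h * y) τ : ENNReal) : EReal) := by
  have hv := u.measurable_weakDeriv
  have hK := hKi.aemeasurable
  have hk := aemeasurable_rescaledKernel hK hh
  have hpv : Measurable fun p : ℝ × ℝ => potential ψ (u.weakDeriv p.1) :=
    (measurable_potential hψ).comp (hv.comp measurable_fst)
  have hpm : Measurable fun p : ℝ × ℝ => potential ψ (pointAverage u.weakDeriv p.2 p.1) :=
    (measurable_potential hψ).comp (measurable_pointAverage_comp hv measurable_snd measurable_fst)
  have hk0 := rescaledKernel_nonneg hK0 hh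
  have hp0 := potential_nonneg hψ hγ0 hγ
  set C : ENNReal := ∫⁻ z, ENNReal.ofReal (rescaledKernel K h z) *
    ∫⁻ τ in Ioc (0 : ℝ) 1, gap ψ u.weakDeriv z τ with hC
  have hgm : Measurable fun z => ∫⁻ τ in Ioc (0 : ℝ) 1, gap ψ u.weakDeriv z τ :=
    (measurable_gap hψ hv measurable_fst measurable_snd).lintegral_prod_right'
  have key : extIntegral volume (fun p : ℝ × ℝ => rescaledKernel K h p.2 *
      (potential ψ (u.weakDeriv p.1) - potential ψ (pointAverage u.weakDeriv p.2 p.1))) = C := by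
    set A : ENNReal := ∫⁻ p : ℝ × ℝ, ENNReal.ofReal (rescaledKernel K h p.2 *
      potential ψ (u.weakDeriv p.1)) with hA
    set B : ENNReal := ∫⁻ p : ℝ × ℝ, ENNReal.ofReal (rescaledKernel K h p.2 *
      potential ψ (pointAverage u.weakDeriv p.2 p.1)) with hB
    have hA' : A = ∫⁻ z, ENNReal.ofReal (rescaledKernel K h z) *
        ∫⁻ x, ENNReal.ofReal (potential ψ (u.weakDeriv x)) := by
      exact lintegral_prod_rescaledKernel_mul hK0 hK hh hpv
    have hB' : B = ∫⁻ z, ENNReal.ofReal (rescaledKernel K h z) *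
        ∫⁻ x, ENNReal.ofReal (potential ψ (pointAverage u.weakDeriv z x)) := by
      exact lintegral_prod_rescaledKernel_mul hK0 hK hh hpm
    have hAfin : A ≠ ⊤ := by
      rw [hA', lintegral_mul_const'' _ hk.ennreal_ofReal]
      refine ENNReal.mul_ne_top ?_ hu
      have := lintegral_rescaledKernel_mul K hh fun _ => 1
      simp only [mul_one] at this
      rw [this]
      exact ((hasFiniteIntegral_iff_ofReal (Eventually.of_forall hK0)).1 hKi.2).ne
    have hACB : A = C + B := by
      rw [hA', hB', hC, ← lintegral_add_left'
        (f := fun z => ENNReal.ofReal (rescaledKernel K h z) *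
          ∫⁻ τ in Ioc (0 : ℝ) 1, gap ψ u.weakDeriv z τ)
        (hk.ennreal_ofReal.mul hgm.aemeasurable)]
      refine lintegral_congr fun z => ?_
      rw [← mul_add, lintegral_gap_add hψ hγ0 hγ hv (Lp_integrable_sq u.1.snd) hu]
    have hBfin : B ≠ ⊤ := ne_top_of_le_ne_top hAfin (hACB ▸ le_add_self)
    -- `(a - b)⁺ + b = (a - b)⁻ + a`, and the integrals of `b` and of `(a - b)⁻` are finite
    refine extIntegral_eq_of_eq_add ?_ ?_
    · refine ne_top_of_le_ne_top hBfin (lintegral_mono fun p => ENNReal.ofReal_le_ofReal ?_)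
      rw [← mul_neg]
      exact mul_le_mul_of_nonneg_left (by linarith [hp0 (u.weakDeriv p.1)]) (hk0 _)
    · rw [← ENNReal.add_left_inj hBfin, add_assoc, ← hACB, hA, hB, ← lintegral_add_right' _
        (aemeasurable_rescaledKernel_mul hK hh hpm), ← lintegral_add_right' _
        (aemeasurable_rescaledKernel_mul hK hh hpv)]
      refine lintegral_congr fun p => ?_
      rw [mul_sub]
      exact ofReal_sub_add_ofReal (mul_nonneg (hk0 _) (hp0 _)) (mul_nonneg (hk0 _) (hp0 _))
  have hh2 : (0 : ℝ) ≤ 1 / h ^ 2 := by positivity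
  rw [rateFunctional_eq_extIntegral hf, key, hC, lintegral_rescaledKernel_mul K hh,
    ← max_eq_left hh2, ← EReal.coe_ennreal_ofReal, max_eq_left hh2, ← EReal.coe_ennreal_mul,
    ← lintegral_const_mul' _ _ ENNReal.ofReal_ne_top]
  congr 1
  refine lintegral_congr fun y => ?_
  rw [lintegral_const_mul' _ _ ENNReal.ofReal_ne_top]
  ring

end Rate

/-! ### Weak and strong convergence in `L²(ℝ)` -/

theorem norm_sq_eq_integral (v : L2R) : ‖v‖ ^ 2 = ∫ x, v x ^ 2 := by
  rw [← real_inner_self_eq_norm_sq, inner_eq_integral]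
  simp only [sq]

theorem lintegral_sq_eq (v : L2R) : ∫⁻ x, ENNReal.ofReal (v x ^ 2) = ENNReal.ofReal (‖v‖ ^ 2) := by
  rw [norm_sq_eq_integral, ofReal_integral_eq_lintegral_ofReal (Lp_integrable_sq v)
    (Eventually.of_forall fun x => sq_nonneg _)]

theorem memLp_two_of_lintegral {g : ℝ → ℝ} (hg : Measurable g)
    (h : ∫⁻ x, ENNReal.ofReal (g x ^ 2) ≠ ⊤) : MemLp g 2 := by
  rw [memLp_two_iff_integrable_sq hg.aestronglyMeasurable]
  exact ⟨(hg.pow_const 2).aestronglyMeasurable, (hasFiniteIntegral_iff_ofReal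
    (Eventually.of_forall fun x => sq_nonneg _)).2 (lt_top_iff_ne_top.2 h)⟩

/-- Dominated convergence in `L²(ℝ)`. -/
theorem tendsto_L2_of_dominated {F : ℕ → L2R} {F₀ : L2R} {g : ℝ → ℝ}
    (hg : Integrable fun x => g x ^ 2) (hb : ∀ n, ∀ᵐ x, |F n x| ≤ g x)
    (hlim : ∀ᵐ x, Tendsto (fun n => F n x) atTop (𝓝 (F₀ x))) : Tendsto F atTop (𝓝 F₀) := by
  rw [tendsto_iff_norm_sub_tendsto_zero]
  have h0 : ∀ᵐ x, |F₀ x| ≤ g x := by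
    filter_upwards [ae_all_iff.2 hb, hlim] with x h1 h2
    exact le_of_tendsto h2.abs (Eventually.of_forall h1)
  have hs : ∀ n, ‖F n - F₀‖ ^ 2 = ∫ x, (F n x - F₀ x) ^ 2 := by
    intro n
    rw [norm_sq_eq_integral]
    refine integral_congr_ae ?_
    filter_upwards [Lp.coeFn_sub (F n) F₀] with x hx
    rw [hx, Pi.sub_apply]
  have hsq : Tendsto (fun n => ‖F n - F₀‖ ^ 2) atTop (𝓝 0) := by
    simp only [hs]
    rw [← integral_zero ℝ ℝ (μ := volume)]
    refine tendsto_integral_of_dominated_convergence (fun x => 4 * g x ^ 2)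
      (fun n => (((Lp_measurable (F n)).sub (Lp_measurable F₀)).pow_const 2).aestronglyMeasurable)
      (hg.const_mul 4) (fun n => ?_) ?_
    · filter_upwards [hb n, h0] with x h1 h2
      rw [Real.norm_of_nonneg (sq_nonneg _), ← sq_abs]
      have h3 := (abs_sub (F n x) (F₀ x)).trans (add_le_add h1 h2)
      nlinarith [abs_nonneg (F n x - F₀ x)]
    · filter_upwards [hlim] with x hx
      have := (hx.sub_const (F₀ x)).pow 2
      simpa using this
  have := hsq.sqrt
  simpa using this

/-- Bounded sequences in `L²(ℝ)` have weak limits along ultrafilters. -/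
theorem exists_weak_limit_ultrafilter {Y : ℕ → L2R} {r : ℝ} (hY : ∀ n, ‖Y n‖ ≤ r)
    (𝒰 : Ultrafilter ℕ) :
    ∃ Y₀ : L2R, ‖Y₀‖ ≤ r ∧
      ∀ g : L2R, Tendsto (fun n => inner ℝ (Y n) g) 𝒰 (𝓝 (inner ℝ Y₀ g)) := by
  set D : ℕ → WeakDual ℝ L2R :=
    fun n => StrongDual.toWeakDual (InnerProductSpace.toDual ℝ L2R (Y n)) with hD
  have hc := WeakDual.isCompact_closedBall (𝕜 := ℝ) (E := L2R) 0 r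
  have hmem : ∀ n, D n ∈ WeakDual.toStrongDual ⁻¹' Metric.closedBall (0 : StrongDual ℝ L2R) r := by
    intro n
    rw [mem_preimage, mem_closedBall_zero_iff]
    change ‖InnerProductSpace.toDual ℝ L2R (Y n)‖ ≤ r
    rw [LinearIsometryEquiv.norm_map]
    exact hY n
  obtain ⟨d, hd, hle⟩ := hc.ultrafilter_le_nhds (𝒰.map D) (by
    rw [le_principal_iff]
    exact Filter.mem_map.2 (Eventually.of_forall hmem))
  refine ⟨(InnerProductSpace.toDual ℝ L2R).symm (WeakDual.toStrongDual d), ?_, fun g => ?_⟩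
  · rw [LinearIsometryEquiv.norm_map]
    exact mem_closedBall_zero_iff.1 hd
  · have hev := (WeakDual.eval_continuous (𝕜 := ℝ) g).tendsto d
    have h2 : Tendsto D 𝒰 (𝓝 d) := hle
    have h3 := hev.comp h2
    rw [InnerProductSpace.toDual_symm_apply]
    exact h3

/-- Lower semicontinuity of weighted `L²` norms when the weights converge almost everywhere and the
functions converge in the sense of distributions. The idea is to take a weak limit `Y` of
`√(c n) • W n`; then `Y / √c₀` is the limit of `W n`. -/
theorem exists_limit_of_weighted_bound {W : ℕ → L2R} {c : ℕ → ℝ → ℝ} {c₀ : ℝ → ℝ} {κ C : ℝ}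
    (hκ : 0 < κ) (hC : 0 ≤ C) (hcm : ∀ n, Measurable (c n)) (hc₀m : Measurable c₀)
    (hcκ : ∀ n x, κ ≤ c n x) (hc₀κ : ∀ x, κ ≤ c₀ x)
    (hlim : ∀ᵐ x, Tendsto (fun n => c n x) atTop (𝓝 (c₀ x)))
    (hbd : ∀ n, ∫⁻ x, ENNReal.ofReal (c n x * W n x ^ 2) ≤ ENNReal.ofReal C)
    {L : (ℝ → ℝ) → ℝ}
    (hL : ∀ (φ : ℝ → ℝ) (hφ : ContDiff ℝ ∞ φ) (hc : HasCompactSupport φ),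
      Tendsto (fun n => inner ℝ (W n) (testLp φ hφ hc)) atTop (𝓝 (L φ))) :
    ∃ W₀ : L2R, (∀ (φ : ℝ → ℝ) (hφ : ContDiff ℝ ∞ φ) (hc : HasCompactSupport φ),
      inner ℝ W₀ (testLp φ hφ hc) = L φ) ∧
      ∫⁻ x, ENNReal.ofReal (c₀ x * W₀ x ^ 2) ≤ ENNReal.ofReal C := by
  have hc0 : ∀ n x, 0 < c n x := fun n x => hκ.trans_le (hcκ n x)
  have hc₀0 : ∀ x, 0 < c₀ x := fun x => hκ.trans_le (hc₀κ x)
  have hyeq : ∀ n x, (√(c n x) * W n x) ^ 2 = c n x * W n x ^ 2 := fun n x => by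
    rw [mul_pow, Real.sq_sqrt (hc0 n x).le]
  have hym : ∀ n, MemLp (fun x => √(c n x) * W n x) 2 := fun n =>
    memLp_two_of_lintegral ((hcm n).sqrt.mul (Lp_measurable _)) (by
      simp only [hyeq]
      exact ne_top_of_le_ne_top ENNReal.ofReal_ne_top (hbd n))
  set Y : ℕ → L2R := fun n => (hym n).toLp with hY
  have hYae : ∀ n, ∀ᵐ x, Y n x = √(c n x) * W n x := fun n => MemLp.coeFn_toLp _
  have hYn : ∀ n, ‖Y n‖ ≤ √C := by
    intro n
    refine Real.le_sqrt_of_sq_le ((ENNReal.ofReal_le_ofReal_iff hC).1 ?_)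
    rw [← lintegral_sq_eq]
    refine le_trans (le_of_eq (lintegral_congr_ae ?_)) (hbd n)
    filter_upwards [hYae n] with x hx
    rw [hx, hyeq]
  obtain ⟨Y₀, hY₀, hw⟩ := exists_weak_limit_ultrafilter hYn (hyperfilter ℕ)
  have hle : (hyperfilter ℕ : Filter ℕ) ≤ atTop := Nat.hyperfilter_le_atTop
  -- the weights `1 / √c` are bounded
  have hinv : ∀ t, κ ≤ t → |(√t)⁻¹| ≤ (√κ)⁻¹ := fun t ht => by
    rw [abs_of_nonneg (inv_nonneg.2 (Real.sqrt_nonneg _))]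
    exact inv_anti₀ (Real.sqrt_pos.2 hκ) (Real.sqrt_le_sqrt ht)
  have hmul : ∀ (b : ℝ → ℝ), Measurable b → (∀ x, κ ≤ b x) → ∀ g : L2R,
      MemLp (fun x => (√(b x))⁻¹ * g x) 2 := by
    intro b hb hbκ g
    refine ((Lp.memLp g).const_mul (√κ)⁻¹).mono
      (hb.sqrt.inv.mul (Lp_measurable g)).aestronglyMeasurable (Eventually.of_forall fun x => ?_)
    rw [norm_mul, norm_mul, Real.norm_eq_abs, Real.norm_of_nonneg (by positivity : 0 ≤ (√κ)⁻¹)]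
    exact mul_le_mul_of_nonneg_right (hinv _ (hbκ x)) (norm_nonneg _)
  set W₀ : L2R := (hmul c₀ hc₀m hc₀κ Y₀).toLp with hW₀
  have hW₀ae : ∀ᵐ x, W₀ x = (√(c₀ x))⁻¹ * Y₀ x := MemLp.coeFn_toLp _
  refine ⟨W₀, fun φ hφ hc => ?_, ?_⟩
  · set T := testLp φ hφ hc
    set G : ℕ → L2R := fun n => (hmul (c n) (hcm n) (hcκ n) T).toLp with hG
    set G₀ : L2R := (hmul c₀ hc₀m hc₀κ T).toLp with hG₀
    have hGae : ∀ n, ∀ᵐ x, G n x = (√(c n x))⁻¹ * T x := fun n => MemLp.coeFn_toLp _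
    have hG₀ae : ∀ᵐ x, G₀ x = (√(c₀ x))⁻¹ * T x := MemLp.coeFn_toLp _
    have hGlim : Tendsto G atTop (𝓝 G₀) := by
      refine tendsto_L2_of_dominated (g := fun x => (√κ)⁻¹ * |T x|) ?_ (fun n => ?_) ?_
      · simp only [mul_pow, sq_abs]
        exact (Lp_integrable_sq T).const_mul _
      · filter_upwards [hGae n] with x hx
        rw [hx, abs_mul]
        exact mul_le_mul_of_nonneg_right (hinv _ (hcκ n x)) (abs_nonneg _)
      · filter_upwards [ae_all_iff.2 hGae, hG₀ae, hlim] with x h1 h2 h3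
        simp only [h1, h2]
        exact (h3.sqrt.inv₀ (Real.sqrt_pos.2 (hc₀0 x)).ne').mul_const _
    have h1 : ∀ n, inner ℝ (W n) T = inner ℝ (Y n) (G n) := by
      intro n
      rw [inner_eq_integral, inner_eq_integral]
      refine integral_congr_ae ?_
      filter_upwards [hYae n, hGae n] with x a1 a2
      have := (Real.sqrt_pos.2 (hc0 n x)).ne'
      rw [a1, a2]
      field_simp
    have h2 : inner ℝ W₀ T = inner ℝ Y₀ G₀ := by
      rw [inner_eq_integral, inner_eq_integral]
      refine integral_congr_ae ?_
      filter_upwards [hW₀ae, hG₀ae] with x a1 a2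
      rw [a1, a2]
      ring
    have h3 : Tendsto (fun n => inner ℝ (Y n) (G n - G₀)) atTop (𝓝 0) := by
      refine squeeze_zero_norm (a := fun n => √C * ‖G n - G₀‖) (fun n => ?_) ?_
      · exact (norm_inner_le_norm _ _).trans
          (mul_le_mul_of_nonneg_right (hYn n) (norm_nonneg _))
      · simpa using (tendsto_iff_norm_sub_tendsto_zero.1 hGlim).const_mul √C
    have h4 : Tendsto (fun n => inner ℝ (W n) T) (hyperfilter ℕ : Filter ℕ)
        (𝓝 (inner ℝ Y₀ G₀)) := by
      have := (hw G₀).add (h3.mono_left hle)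
      rw [add_zero] at this
      refine this.congr fun n => ?_
      rw [h1, ← inner_add_right]
      congr 1
      abel
    rw [h2]
    exact tendsto_nhds_unique h4 ((hL φ hφ hc).mono_left hle)
  · have : ∫⁻ x, ENNReal.ofReal (c₀ x * W₀ x ^ 2) = ENNReal.ofReal (‖Y₀‖ ^ 2) := by
      rw [← lintegral_sq_eq]
      refine lintegral_congr_ae ?_
      filter_upwards [hW₀ae] with x hx
      rw [hx, mul_pow, inv_pow, Real.sq_sqrt (hc₀0 x).le, ← mul_assoc,
        mul_inv_cancel₀ (hc₀0 x).ne', one_mul]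
    rw [this]
    refine ENNReal.ofReal_le_ofReal ?_
    calc ‖Y₀‖ ^ 2 ≤ √C ^ 2 := pow_le_pow_left₀ (norm_nonneg _) hY₀ 2
      _ = C := Real.sq_sqrt hC

theorem exists_subseq_tendsto_ae {F : ℕ → L2R} {F₀ : L2R} (h : Tendsto F atTop (𝓝 F₀)) :
    ∃ ns : ℕ → ℕ, StrictMono ns ∧
      ∀ᵐ x, Tendsto (fun n => F (ns n) x) atTop (𝓝 (F₀ x)) :=
  (tendstoInMeasure_of_tendsto_Lp h).exists_seq_tendsto_ae

/-! ### The lower bound -/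

/-- The energy `½ ∫ ψ(v) |v'|²`, which is `+∞` if `v` has no weak derivative in `L²(ℝ)`. -/
noncomputable def limitEnergy (ψ : ℝ → ℝ) (v : L2R) : ENNReal :=
  ⨅ (w : L2R) (_ : IsWeakDeriv v w), ∫⁻ x, ENNReal.ofReal (ψ (v x) / 2 * w x ^ 2)

section Lower

variable {ψ : ℝ → ℝ} {γ : ℝ}

theorem limitEnergy_eq {v w : L2R} (h : IsWeakDeriv v w) :
    limitEnergy ψ v = ∫⁻ x, ENNReal.ofReal (ψ (v x) / 2 * w x ^ 2) := by
  refine le_antisymm (iInf₂_le w h) (le_iInf₂ fun w' h' => ?_)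
  rw [h.unique h']

theorem limitEnergy_eq_top {v : L2R} (h : ¬ ∃ w, IsWeakDeriv v w) : limitEnergy ψ v = ⊤ := by
  push Not at h
  simp [limitEnergy, h]

/-- The Bregman gap as a weighted `L²` norm. -/
theorem gap_eq_lintegral (v : L2R) (s τ : ℝ) :
    gap ψ v s τ = ∫⁻ x, ENNReal.ofReal
      (taylorWeight ψ (movingAverage s v x) (shift (τ * s) v x) *
        (shift (τ * s) v - movingAverage s v : L2R) x ^ 2) := by
  refine lintegral_congr_ae ?_
  filter_upwards [movingAverage_ae v s, shift_ae (τ * s) v,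
    Lp.coeFn_sub (shift (τ * s) v) (movingAverage s v)] with x h1 h2 h3
  rw [h3, Pi.sub_apply, h1, h2, bregman]

theorem ofReal_mul_gap (v : L2R) (s τ h : ℝ) :
    ENNReal.ofReal (1 / h ^ 2) * gap ψ v s τ = ∫⁻ x, ENNReal.ofReal
      (taylorWeight ψ (movingAverage s v x) (shift (τ * s) v x) *
        (h⁻¹ • (shift (τ * s) v - movingAverage s v) : L2R) x ^ 2) := by
  rw [gap_eq_lintegral, ← lintegral_const_mul' _ _ ENNReal.ofReal_ne_top]
  refine lintegral_congr_ae ?_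
  filter_upwards [Lp.coeFn_smul h⁻¹ (shift (τ * s) v - movingAverage s v)] with x hx
  rw [hx, ← ENNReal.ofReal_mul (by positivity), Pi.smul_apply, smul_eq_mul]
  congr 1
  ring

theorem tendsto_shift_movingAverage {v : ℕ → L2R} {v₀ : L2R} (hv : Tendsto v atTop (𝓝 v₀))
    {s : ℕ → ℝ} (hs : Tendsto s atTop (𝓝 0)) (τ : ℝ) :
    Tendsto (fun n => shift (τ * s n) (v n)) atTop (𝓝 v₀) ∧
      Tendsto (fun n => movingAverage (s n) (v n)) atTop (𝓝 v₀) := by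
  constructor
  · have h1 := (continuous_shift.tendsto (τ * 0, v₀)).comp
      ((hs.const_mul τ).prodMk_nhds hv)
    simp only [mul_zero, shift_zero] at h1
    exact h1
  · have h1 := (continuous_movingAverage.tendsto (0, v₀)).comp (hs.prodMk_nhds hv)
    simp only [movingAverage_zero] at h1
    exact h1

/-- Along a subsequence the Taylor weights converge almost everywhere. -/
theorem exists_subseq_taylorWeight_tendsto (hψ : Continuous ψ) {v : ℕ → L2R} {v₀ : L2R}
    (hv : Tendsto v atTop (𝓝 v₀)) {s : ℕ → ℝ} (hs : Tendsto s atTop (𝓝 0)) (τ : ℝ) :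
    ∃ ns : ℕ → ℕ, StrictMono ns ∧ ∀ᵐ x, Tendsto (fun n => taylorWeight ψ
      (movingAverage (s (ns n)) (v (ns n)) x) (shift (τ * s (ns n)) (v (ns n)) x))
      atTop (𝓝 (ψ (v₀ x) / 2)) := by
  obtain ⟨h1, h2⟩ := tendsto_shift_movingAverage hv hs τ
  obtain ⟨ns, hns, hae⟩ := exists_subseq_tendsto_ae h1
  obtain ⟨ms, hms, hae'⟩ := exists_subseq_tendsto_ae (h2.comp hns.tendsto_atTop)
  refine ⟨ns ∘ ms, hns.comp hms, ?_⟩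
  filter_upwards [hae, hae'] with x a1 a2
  have := ((continuous_taylorWeight hψ).tendsto (v₀ x, v₀ x)).comp
    (a2.prodMk_nhds (a1.comp hms.tendsto_atTop))
  simp only [taylorWeight_self] at this
  exact this

/-- Difference quotients of a convergent sequence converge in the sense of distributions. -/
theorem tendsto_inner_differenceQuotient {v : ℕ → L2R} {v₀ : L2R} (hv : Tendsto v atTop (𝓝 v₀))
    {h : ℕ → ℝ} (hh0 : ∀ n, h n ≠ 0) (hh : Tendsto h atTop (𝓝 0)) (y τ : ℝ)
    (φ : ℝ → ℝ) (hφ : ContDiff ℝ ∞ φ) (hc : HasCompactSupport φ) :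
    Tendsto (fun n => inner ℝ ((h n)⁻¹ • (shift (τ * (h n * y)) (v n)
      - movingAverage (h n * y) (v n))) (testLp φ hφ hc)) atTop
      (𝓝 (-(y * (τ - 1 / 2)) * ∫ x, v₀ x * deriv φ x)) := by
  set T := testLp (deriv φ) (contDiff_deriv_test hφ) hc.deriv with hT
  have hd := isWeakDeriv_testLp φ hφ hc
  have e : ∀ n, inner ℝ ((h n)⁻¹ • (shift (τ * (h n * y)) (v n)
      - movingAverage (h n * y) (v n))) (testLp φ hφ hc) =
      -y * inner ℝ (v n) (drift τ (-(h n * y)) T) := by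
    intro n
    rw [real_inner_smul_left, inner_shift_sub_movingAverage, hd.shift_sub_movingAverage,
      real_inner_smul_right, ← hT]
    have := hh0 n
    field_simp
  simp only [e]
  have hs : Tendsto (fun n => -(h n * y)) atTop (𝓝 0) := by
    simpa using (hh.mul_const y).neg
  have := (hv.inner ((tendsto_drift τ T).comp hs) (𝕜 := ℝ)).const_mul (-y)
  rw [real_inner_smul_right, inner_testLp] at this
  rw [show -(y * (τ - 1 / 2)) * ∫ x, v₀ x * deriv φ x
    = -y * ((τ - 1 / 2) * ∫ x, v₀ x * deriv φ x) by ring]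
  exact this

/-- The lower bound for fixed `y` and `τ` along a sequence with bounded gaps. The functions
`(v n (· + τ s) - M) / h n`, with `s = h n * y` and `M` the moving average of `v n` over segments of
length `s`, tend to `y (τ - 1/2) v₀'` in the sense of distributions, and the gap is their weighted
`L²` norm. -/
theorem limitEnergy_le_of_gap_le (hψ : Continuous ψ) (hγ0 : 0 < γ) (hγ : ∀ t, γ ≤ ψ t)
    {v : ℕ → L2R} {v₀ : L2R} (hv : Tendsto v atTop (𝓝 v₀)) {h : ℕ → ℝ} (hh0 : ∀ n, h n ≠ 0)
    (hh : Tendsto h atTop (𝓝 0)) {y τ : ℝ} (hy : y ≠ 0) (hτ : τ ≠ 1 / 2) {C : ℝ} (hC : 0 ≤ C)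
    (hbd : ∀ n, ENNReal.ofReal (1 / h n ^ 2) * gap ψ (v n) (h n * y) τ ≤ ENNReal.ofReal C) :
    ENNReal.ofReal ((y * (τ - 1 / 2)) ^ 2) * limitEnergy ψ v₀ ≤ ENNReal.ofReal C := by
  have hs : Tendsto (fun n => h n * y) atTop (𝓝 0) := by simpa using hh.mul_const y
  obtain ⟨ns, hns, hae⟩ := exists_subseq_taylorWeight_tendsto hψ hv hs τ
  have hk : y * (τ - 1 / 2) ≠ 0 := mul_ne_zero hy (sub_ne_zero.2 hτ)
  set k := y * (τ - 1 / 2) with hkd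
  obtain ⟨W, hW, hWC⟩ := exists_limit_of_weighted_bound (half_pos hγ0) hC
    (W := fun n => (h (ns n))⁻¹ • (shift (τ * (h (ns n) * y)) (v (ns n))
      - movingAverage (h (ns n) * y) (v (ns n))))
    (c := fun n x => taylorWeight ψ (movingAverage (h (ns n) * y) (v (ns n)) x)
      (shift (τ * (h (ns n) * y)) (v (ns n)) x)) (c₀ := fun x => ψ (v₀ x) / 2)
    (fun n => (continuous_taylorWeight hψ).measurable.comp
      ((Lp_measurable _).prodMk (Lp_measurable _)))
    ((hψ.measurable.comp (Lp_measurable v₀)).div_const 2)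
    (fun n x => le_taylorWeight hψ hγ _ _) (fun x => by linarith [hγ (v₀ x)]) hae
    (fun n => (ofReal_mul_gap _ _ _ _).symm.trans_le (hbd (ns n)))
    (L := fun φ => -k * ∫ x, v₀ x * deriv φ x)
    (fun φ hφ hc => tendsto_inner_differenceQuotient (hv.comp hns.tendsto_atTop)
      (fun n => hh0 (ns n)) (hh.comp hns.tendsto_atTop) y τ φ hφ hc)
  have hw : IsWeakDeriv v₀ (k⁻¹ • W) := by
    rw [isWeakDeriv_iff_inner]
    intro φ hφ hc
    rw [real_inner_smul_left, hW, inner_testLp]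
    field_simp
  refine le_trans (le_of_eq ?_) hWC
  rw [limitEnergy_eq hw, ← lintegral_const_mul' _ _ ENNReal.ofReal_ne_top]
  refine lintegral_congr_ae ?_
  filter_upwards [Lp.coeFn_smul k⁻¹ W] with x hx
  rw [← ENNReal.ofReal_mul (sq_nonneg _), hx, Pi.smul_apply, smul_eq_mul]
  congr 1
  field_simp

/-- The lower bound for fixed `y` and `τ`. -/
theorem le_liminf_gap (hψ : Continuous ψ) (hγ0 : 0 < γ) (hγ : ∀ t, γ ≤ ψ t)
    {v : ℝ → L2R} {v₀ : L2R} (hv : Tendsto v (𝓝[>] 0) (𝓝 v₀)) {y τ : ℝ} (hy : y ≠ 0)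
    (hτ : τ ≠ 1 / 2) :
    ENNReal.ofReal ((y * (τ - 1 / 2)) ^ 2) * limitEnergy ψ v₀ ≤
      liminf (fun h : ℝ => ENNReal.ofReal (1 / h ^ 2) * gap ψ (v h) (h * y) τ) (𝓝[>] 0) := by
  by_contra! hlt
  obtain ⟨C, hC1, hC2⟩ := exists_between hlt
  have hf := (frequently_lt_of_liminf_lt (by isBoundedDefault) hC1).and_eventually
    self_mem_nhdsWithin
  obtain ⟨h, hh, hp⟩ := exists_seq_forall_of_frequently hf
  have hCt : C ≠ ⊤ := hC2.ne_top
  have := limitEnergy_le_of_gap_le hψ hγ0 hγ (hv.comp hh) (fun n => (hp n).2.ne')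
    (hh.mono_right nhdsWithin_le_nhds) hy hτ (C := C.toReal) ENNReal.toReal_nonneg (fun n => by
      rw [ENNReal.ofReal_toReal hCt]
      exact (hp n).1.le)
  rw [ENNReal.ofReal_toReal hCt] at this
  exact absurd this (not_le.2 hC2)

theorem lintegral_sq_sub_half :
    ∫⁻ τ in Ioc (0 : ℝ) 1, ENNReal.ofReal ((τ - 1 / 2) ^ 2) = ENNReal.ofReal (1 / 12) := by
  have hc : Continuous fun τ : ℝ => (τ - 1 / 2) ^ 2 := by fun_prop
  rw [← ofReal_integral_eq_lintegral_ofReal (hc.integrableOn_Ioc)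
    (Eventually.of_forall fun x => sq_nonneg _), ← intervalIntegral.integral_of_le zero_le_one]
  congr 1
  rw [intervalIntegral.integral_comp_sub_right (fun τ => τ ^ 2) (1 / 2 : ℝ), integral_pow]
  norm_num

/-- The integral over `y` and `τ` of the densities in the limit. -/
theorem lintegral_kernel_sq {K : ℝ → ℝ} (hK0 : ∀ z, 0 ≤ K z) (hK : AEMeasurable K)
    (hK2 : Integrable fun z => K z * z ^ 2) (E : ENNReal) :
    ∫⁻ y, ENNReal.ofReal (K y) * ∫⁻ τ in Ioc (0 : ℝ) 1,
      ENNReal.ofReal ((y * (τ - 1 / 2)) ^ 2) * E =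
      ENNReal.ofReal (1 / 12 * ∫ z, K z * z ^ 2) * E := by
  have h1 : ∀ y : ℝ, ENNReal.ofReal (K y) * ∫⁻ τ in Ioc (0 : ℝ) 1,
      ENNReal.ofReal ((y * (τ - 1 / 2)) ^ 2) * E =
      ENNReal.ofReal (K y * y ^ 2) * (ENNReal.ofReal (1 / 12) * E) := by
    intro y
    rw [lintegral_mul_const _ (by fun_prop)]
    simp only [mul_pow, ENNReal.ofReal_mul (sq_nonneg y)]
    rw [lintegral_const_mul' _ _ ENNReal.ofReal_ne_top, lintegral_sq_sub_half,
      ENNReal.ofReal_mul (hK0 y)]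
    ring
  simp only [h1]
  rw [lintegral_mul_const'' _ (by fun_prop), ← ofReal_integral_eq_lintegral_ofReal hK2
    (Eventually.of_forall fun z => mul_nonneg (hK0 z) (sq_nonneg z)),
    ENNReal.ofReal_mul (by norm_num : (0 : ℝ) ≤ 1 / 12)]
  ring

theorem aemeasurable_kernel_mul_gap (hψ : Continuous ψ) {v : ℝ → ℝ} (hv : Measurable v)
    {K : ℝ → ℝ} (hK : AEMeasurable K) (c : ENNReal) (h : ℝ) :
    AEMeasurable fun y => ENNReal.ofReal (K y) * ∫⁻ τ in Ioc (0 : ℝ) 1, c * gap ψ v (h * y) τ := by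
  have hg : Measurable fun p : ℝ × ℝ => c * gap ψ v (h * p.1) p.2 :=
    (measurable_gap hψ hv (measurable_fst.const_mul h) measurable_snd).const_mul c
  exact hK.ennreal_ofReal.mul (Measurable.aemeasurable hg.lintegral_prod_right')

/-- The lower bound after integration over `y` and `τ`, by Fatou's lemma. -/
theorem le_liminf_lintegral_gap (hψ : Continuous ψ) (hγ0 : 0 < γ) (hγ : ∀ t, γ ≤ ψ t)
    {K : ℝ → ℝ} (hK0 : ∀ z, 0 ≤ K z) (hK : AEMeasurable K)
    (hK2 : Integrable fun z => K z * z ^ 2)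
    {v : ℝ → L2R} {v₀ : L2R} (hv : Tendsto v (𝓝[>] 0) (𝓝 v₀)) :
    ENNReal.ofReal (1 / 12 * ∫ z, K z * z ^ 2) * limitEnergy ψ v₀ ≤
      liminf (fun h : ℝ => ∫⁻ y, ENNReal.ofReal (K y) * ∫⁻ τ in Ioc (0 : ℝ) 1,
        ENNReal.ofReal (1 / h ^ 2) * gap ψ (v h) (h * y) τ) (𝓝[>] 0) := by
  rw [← lintegral_kernel_sq hK0 hK hK2]
  refine le_trans (lintegral_mono_ae ?_) (lintegral_liminf_le' fun h =>
    aemeasurable_kernel_mul_gap hψ (Lp_measurable (v h)) hK _ h)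
  filter_upwards [Measure.ae_ne volume 0] with y hy
  calc ENNReal.ofReal (K y) * ∫⁻ τ in Ioc (0 : ℝ) 1,
        ENNReal.ofReal ((y * (τ - 1 / 2)) ^ 2) * limitEnergy ψ v₀
      ≤ ENNReal.ofReal (K y) * liminf (fun h : ℝ => ∫⁻ τ in Ioc (0 : ℝ) 1,
        ENNReal.ofReal (1 / h ^ 2) * gap ψ (v h) (h * y) τ) (𝓝[>] 0) := by
        gcongr
        refine le_trans (lintegral_mono_ae ?_) (lintegral_liminf_le fun h =>
          (measurable_gap hψ (Lp_measurable (v h)) measurable_const measurable_id).const_mul _)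
        filter_upwards [ae_restrict_of_ae (Measure.ae_ne volume (1 / 2 : ℝ))] with τ hτ
        exact le_liminf_gap hψ hγ0 hγ hv hy hτ
    _ ≤ _ := by
        have := ENNReal.le_liminf_mul (f := 𝓝[>] (0 : ℝ)) (u := fun _ => ENNReal.ofReal (K y))
          (v := fun h : ℝ => ∫⁻ τ in Ioc (0 : ℝ) 1,
            ENNReal.ofReal (1 / h ^ 2) * gap ψ (v h) (h * y) τ)
        rw [liminf_const] at this
        exact this

end Lower

/-! ### Convergence on functions with a second derivative -/

/-- Weighted `L²` norms converge when the weights are bounded and converge almost everywhere and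
the functions converge in `L²(ℝ)`. -/
theorem tendsto_lintegral_weight_mul_sq {c : ℕ → ℝ → ℝ} {c₀ : ℝ → ℝ} {q : ℕ → L2R} {q₀ : L2R}
    {M : ℝ} (hcm : ∀ n, Measurable (c n)) (hc₀m : Measurable c₀) (hc0 : ∀ n x, 0 ≤ c n x)
    (hc₀0 : ∀ x, 0 ≤ c₀ x) (hcM : ∀ n, ∀ᵐ x, c n x ≤ M)
    (hlim : ∀ᵐ x, Tendsto (fun n => c n x) atTop (𝓝 (c₀ x))) (hq : Tendsto q atTop (𝓝 q₀)) :
    Tendsto (fun n => ∫⁻ x, ENNReal.ofReal (c n x * q n x ^ 2)) atTop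
      (𝓝 (∫⁻ x, ENNReal.ofReal (c₀ x * q₀ x ^ 2))) := by
  have hc₀M : ∀ᵐ x, c₀ x ≤ M := by
    filter_upwards [ae_all_iff.2 hcM, hlim] with x h1 h2
    exact le_of_tendsto h2 (Eventually.of_forall h1)
  have hmul : ∀ (b : ℝ → ℝ), Measurable b → (∀ᵐ x, b x ≤ M) → ∀ g : L2R,
      MemLp (fun x => √(b x) * g x) 2 := by
    intro b hb hbM g
    refine ((Lp.memLp g).const_mul √M).mono
      (hb.sqrt.mul (Lp_measurable g)).aestronglyMeasurable ?_
    filter_upwards [hbM] with x hx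
    rw [norm_mul, norm_mul, Real.norm_of_nonneg (Real.sqrt_nonneg _),
      Real.norm_of_nonneg (Real.sqrt_nonneg _)]
    exact mul_le_mul_of_nonneg_right (Real.sqrt_le_sqrt hx) (norm_nonneg _)
  -- `F n = √(c n) • q n` is compared with `G n = √(c n) • q₀`
  set F : ℕ → L2R := fun n => (hmul (c n) (hcm n) (hcM n) (q n)).toLp with hF
  set G : ℕ → L2R := fun n => (hmul (c n) (hcm n) (hcM n) q₀).toLp with hG
  set F₀ : L2R := (hmul c₀ hc₀m hc₀M q₀).toLp with hF₀
  have hFae : ∀ n, ∀ᵐ x, F n x = √(c n x) * q n x := fun n => MemLp.coeFn_toLp _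
  have hGae : ∀ n, ∀ᵐ x, G n x = √(c n x) * q₀ x := fun n => MemLp.coeFn_toLp _
  have hF₀ae : ∀ᵐ x, F₀ x = √(c₀ x) * q₀ x := MemLp.coeFn_toLp _
  have hGlim : Tendsto G atTop (𝓝 F₀) := by
    refine tendsto_L2_of_dominated (g := fun x => √M * |q₀ x|) ?_ (fun n => ?_) ?_
    · simp only [mul_pow, sq_abs]
      exact (Lp_integrable_sq q₀).const_mul _
    · filter_upwards [hGae n, hcM n] with x hx h2
      rw [hx, abs_mul, abs_of_nonneg (Real.sqrt_nonneg _)]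
      exact mul_le_mul_of_nonneg_right (Real.sqrt_le_sqrt h2) (abs_nonneg _)
    · filter_upwards [ae_all_iff.2 hGae, hF₀ae, hlim] with x h1 h2 h3
      simp only [h1, h2]
      exact h3.sqrt.mul_const _
  have hFG : Tendsto (fun n => F n - G n) atTop (𝓝 0) := by
    refine squeeze_zero_norm (a := fun n => √M * ‖q n - q₀‖) (fun n => ?_) ?_
    · refine Lp.norm_le_mul_norm_of_ae_le_mul ?_
      filter_upwards [hFae n, hGae n, Lp.coeFn_sub (F n) (G n), Lp.coeFn_sub (q n) q₀,
        hcM n] with x h1 h2 h3 h4 h5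
      rw [h3, h4, Pi.sub_apply, Pi.sub_apply, h1, h2, ← mul_sub, norm_mul,
        Real.norm_of_nonneg (Real.sqrt_nonneg _)]
      exact mul_le_mul_of_nonneg_right (Real.sqrt_le_sqrt h5) (norm_nonneg _)
    · simpa using (tendsto_iff_norm_sub_tendsto_zero.1 hq).const_mul √M
  have hFlim : Tendsto F atTop (𝓝 F₀) := by simpa using hFG.add hGlim
  have e : ∀ (b : ℝ → ℝ), (∀ x, 0 ≤ b x) → ∀ (g H : L2R), (∀ᵐ x, H x = √(b x) * g x) →
      ∫⁻ x, ENNReal.ofReal (b x * g x ^ 2) = ENNReal.ofReal (‖H‖ ^ 2) := by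
    intro b hb g H hH
    rw [← lintegral_sq_eq]
    refine lintegral_congr_ae ?_
    filter_upwards [hH] with x hx
    rw [hx, mul_pow, Real.sq_sqrt (hb x)]
  rw [e c₀ hc₀0 q₀ F₀ hF₀ae]
  simp only [fun n => e (c n) (hc0 n) (q n) (F n) (hFae n)]
  exact ENNReal.tendsto_ofReal (hFlim.norm.pow 2)

/-- A function with a weak derivative is bounded: its oscillation over segments of unit length and
its averages over such segments are bounded. -/
theorem IsWeakDeriv.exists_bound {v w : L2R} (h : IsWeakDeriv v w) : ∃ R, ∀ᵐ x, |v x| ≤ R := by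
  have hq := H1.differenceQuotient_ae_prod ⟨WithLp.toLp 2 (v, w), h⟩
  rw [Measure.volume_eq_prod] at hq
  refine ⟨(2 + ∫ y, w y ^ 2) + ∫ y, v y ^ 2, ?_⟩
  filter_upwards [Measure.ae_ae_of_ae_prod hq] with x hx
  have hi : Integrable fun z => v (x + z) ^ 2 := (Lp_integrable_sq v).comp_add_left x
  have hb : ∀ᵐ z ∂(volume.restrict (Ioc (0 : ℝ) 1)),
      |v x| ≤ (2 + ∫ y, w y ^ 2) + v (x + z) ^ 2 := by
    filter_upwards [ae_restrict_of_ae hx, ae_restrict_mem measurableSet_Ioc] with z h1 hz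
    replace h1 : (v (x + z) - v x) / z = pointAverage w z x := h1
    have h2 := abs_pointAverage_le (Lp_integrable_sq w) hz.1.ne' x
    rw [← h1, abs_div, abs_inv, abs_of_pos hz.1, div_le_iff₀ hz.1, add_mul, mul_right_comm,
      inv_mul_cancel₀ hz.1.ne', one_mul, one_mul] at h2
    have h3 : |v x| ≤ |v (x + z)| + |v (x + z) - v x| := by
      have := abs_sub_abs_le_abs_sub (v x) (v (x + z))
      rw [abs_sub_comm] at this
      linarith
    nlinarith [sq_nonneg (|v (x + z)| - 1), sq_abs (v (x + z)), abs_nonneg (v (x + z)), hz.2]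
  have h4 := integral_mono_ae (μ := volume.restrict (Ioc (0 : ℝ) 1)) (integrable_const _)
    ((integrable_const _).add hi.integrableOn) hb
  rw [integral_add' (integrable_const _) hi.integrableOn] at h4
  have h5 := setIntegral_le_integral (s := Ioc (0 : ℝ) 1) hi
    (Eventually.of_forall fun z => sq_nonneg _)
  have h6 : ∫ z, v (x + z) ^ 2 = ∫ y, v y ^ 2 :=
    integral_add_left_eq_self (fun y => v y ^ 2) x
  simp only [integral_const, probReal_univ, one_smul] at h4
  linarith

section Upper

variable {ψ : ℝ → ℝ} {γ : ℝ}

theorem ae_abs_pointAverage_le {v : ℝ → ℝ} {R : ℝ} (hR : ∀ᵐ x, |v x| ≤ R) (s : ℝ) :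
    ∀ᵐ x, |pointAverage v s x| ≤ R := by
  filter_upwards [ae_ae_shift hR s] with x hx
  rw [pointAverage_eq]
  have := norm_integral_le_of_norm_le_const (μ := volume.restrict (Ioc (0 : ℝ) 1))
    (f := fun τ => v (x + τ * s)) hx
  simpa using this

theorem exists_ae_taylorWeight_le (hψ : Continuous ψ) {v w : L2R} (h : IsWeakDeriv v w) :
    ∃ M, 0 ≤ M ∧ ∀ s τ, ∀ᵐ x,
      taylorWeight ψ (movingAverage s v x) (shift (τ * s) v x) ≤ M := by
  obtain ⟨R, hR⟩ := h.exists_bound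
  obtain ⟨M, hM0, hM⟩ := exists_taylorWeight_le hψ R
  refine ⟨M, hM0, fun s τ => ?_⟩
  have hs : ∀ᵐ x, |v (x + τ * s)| ≤ R :=
    (measurePreserving_add_right volume (τ * s)).quasiMeasurePreserving.ae hR
  filter_upwards [ae_abs_pointAverage_le hR s, movingAverage_ae v s, shift_ae (τ * s) v,
    hs] with x h1 h2 h3 h4
  rw [h2, h3]
  exact hM _ _ h1 h4

theorem IsWeakDeriv.inv_smul_shift_sub {v w : L2R} (hw : IsWeakDeriv v w) {h : ℝ} (hh : h ≠ 0)
    (y τ : ℝ) : h⁻¹ • (shift (τ * (h * y)) v - movingAverage (h * y) v) =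
      y • drift τ (h * y) w := by
  rw [hw.shift_sub_movingAverage, smul_smul, inv_mul_cancel_left₀ hh]

/-- For fixed `y` and `τ` the gap converges if `v` has a weak derivative: by
`IsWeakDeriv.inv_smul_shift_sub` the difference quotients converge strongly. -/
theorem tendsto_gap (hψ : Continuous ψ) (hγ0 : 0 < γ) (hγ : ∀ t, γ ≤ ψ t) {v w : L2R}
    (hw : IsWeakDeriv v w) (y τ : ℝ) :
    Tendsto (fun h : ℝ => ENNReal.ofReal (1 / h ^ 2) * gap ψ v (h * y) τ) (𝓝[>] 0)
      (𝓝 (ENNReal.ofReal ((y * (τ - 1 / 2)) ^ 2) * limitEnergy ψ v)) := by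
  obtain ⟨M, hM0, hM⟩ := exists_ae_taylorWeight_le hψ hw
  refine tendsto_of_subseq_tendsto fun h hh => ?_
  have hh0 : Tendsto h atTop (𝓝 0) := hh.mono_right nhdsWithin_le_nhds
  have hpos : ∀ᶠ n in atTop, 0 < h n := hh.eventually self_mem_nhdsWithin
  have hs : Tendsto (fun n => h n * y) atTop (𝓝 0) := by simpa using hh0.mul_const y
  obtain ⟨ns, hns, hae⟩ := exists_subseq_taylorWeight_tendsto hψ
    (tendsto_const_nhds (x := v)) hs τ
  refine ⟨ns, ?_⟩
  have hlim := tendsto_lintegral_weight_mul_sq (M := M)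
    (c := fun n x => taylorWeight ψ (movingAverage (h (ns n) * y) v x)
      (shift (τ * (h (ns n) * y)) v x)) (c₀ := fun x => ψ (v x) / 2)
    (q := fun n => y • drift τ (h (ns n) * y) w) (q₀ := y • ((τ - 1 / 2) • w))
    (fun n => (continuous_taylorWeight hψ).measurable.comp
      ((Lp_measurable _).prodMk (Lp_measurable _)))
    ((hψ.measurable.comp (Lp_measurable v)).div_const 2)
    (fun n x => (taylorWeight_pos hψ hγ0 hγ _ _).le)
    (fun x => by linarith [hγ (v x)]) (fun n => hM _ _) hae
    (((tendsto_drift τ w).comp (hs.comp hns.tendsto_atTop)).const_smul y)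
  have e : ENNReal.ofReal ((y * (τ - 1 / 2)) ^ 2) * limitEnergy ψ v =
      ∫⁻ x, ENNReal.ofReal (ψ (v x) / 2 * (y • ((τ - 1 / 2) • w) : L2R) x ^ 2) := by
    rw [limitEnergy_eq hw, ← lintegral_const_mul' _ _ ENNReal.ofReal_ne_top]
    refine lintegral_congr_ae ?_
    rw [smul_smul]
    filter_upwards [Lp.coeFn_smul (y * (τ - 1 / 2)) w] with x hx
    rw [hx, ← ENNReal.ofReal_mul (sq_nonneg _), Pi.smul_apply, smul_eq_mul]
    congr 1
    ring
  rw [e]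
  refine hlim.congr' ?_
  filter_upwards [hns.tendsto_atTop.eventually hpos] with n hn
  rw [ofReal_mul_gap, hw.inv_smul_shift_sub hn.ne']

/-- The bound that dominates the gaps of a function with a weak derivative. -/
theorem exists_gap_le (hψ : Continuous ψ) {v w : L2R} (hw : IsWeakDeriv v w) :
    ∃ C, 0 ≤ C ∧ ∀ h : ℝ, 0 < h → ∀ y, ∀ τ ∈ Icc (0 : ℝ) 1,
      ENNReal.ofReal (1 / h ^ 2) * gap ψ v (h * y) τ ≤ ENNReal.ofReal (C * y ^ 2) := by
  obtain ⟨M, hM0, hM⟩ := exists_ae_taylorWeight_le hψ hw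
  refine ⟨M * (2 * ‖w‖) ^ 2, by positivity, fun h hh y τ hτ => ?_⟩
  rw [ofReal_mul_gap, hw.inv_smul_shift_sub hh.ne']
  calc _ ≤ ∫⁻ x, ENNReal.ofReal M * ENNReal.ofReal ((y • drift τ (h * y) w : L2R) x ^ 2) := by
        refine lintegral_mono_ae ?_
        filter_upwards [hM (h * y) τ] with x hx
        rw [← ENNReal.ofReal_mul hM0]
        exact ENNReal.ofReal_le_ofReal (mul_le_mul_of_nonneg_right hx (sq_nonneg _))
    _ ≤ _ := by
        rw [lintegral_const_mul' _ _ ENNReal.ofReal_ne_top, lintegral_sq_eq,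
          ← ENNReal.ofReal_mul hM0, norm_smul, mul_pow, Real.norm_eq_abs, sq_abs]
        refine ENNReal.ofReal_le_ofReal ?_
        have := pow_le_pow_left₀ (norm_nonneg _) (norm_drift_le hτ (h * y) w) 2
        rw [mul_assoc, mul_comm (y ^ 2)]
        gcongr

/-- Convergence after integration over `y` and `τ`. It shows that a constant family is a recovery
family. -/
theorem tendsto_lintegral_gap (hψ : Continuous ψ) (hγ0 : 0 < γ) (hγ : ∀ t, γ ≤ ψ t)
    {K : ℝ → ℝ} (hK0 : ∀ z, 0 ≤ K z) (hK : AEMeasurable K)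
    (hK2 : Integrable fun z => K z * z ^ 2) {v w : L2R} (hw : IsWeakDeriv v w) :
    Tendsto (fun h : ℝ => ∫⁻ y, ENNReal.ofReal (K y) * ∫⁻ τ in Ioc (0 : ℝ) 1,
        ENNReal.ofReal (1 / h ^ 2) * gap ψ v (h * y) τ) (𝓝[>] 0)
      (𝓝 (ENNReal.ofReal (1 / 12 * ∫ z, K z * z ^ 2) * limitEnergy ψ v)) := by
  obtain ⟨C, hC0, hC⟩ := exists_gap_le hψ hw
  have hpos : ∀ᶠ h : ℝ in 𝓝[>] 0, 0 < h := self_mem_nhdsWithin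
  have hin : ∀ h : ℝ, 0 < h → ∀ y, ∀ᵐ τ ∂(volume.restrict (Ioc (0 : ℝ) 1)),
      ENNReal.ofReal (1 / h ^ 2) * gap ψ v (h * y) τ ≤ ENNReal.ofReal (C * y ^ 2) := by
    intro h hh y
    filter_upwards [ae_restrict_mem measurableSet_Ioc] with τ hτ
    exact hC h hh y τ (Ioc_subset_Icc_self hτ)
  rw [← lintegral_kernel_sq hK0 hK hK2]
  refine tendsto_lintegral_filter_of_dominated_convergence'
    (fun y => ENNReal.ofReal (C * (K y * y ^ 2)))
    (Eventually.of_forall fun h => aemeasurable_kernel_mul_gap hψ (Lp_measurable v) hK _ h) ?_ ?_ ?_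
  · filter_upwards [hpos] with h hh
    refine Eventually.of_forall fun y => ?_
    have h1 := lintegral_mono_ae (hin h hh y)
    rw [lintegral_const, measure_univ, mul_one] at h1
    calc _ ≤ ENNReal.ofReal (K y) * ENNReal.ofReal (C * y ^ 2) := by gcongr
      _ = _ := by
        rw [← ENNReal.ofReal_mul (hK0 y)]
        congr 1
        ring
  · exact ((hasFiniteIntegral_iff_ofReal (Eventually.of_forall fun y =>
      mul_nonneg hC0 (mul_nonneg (hK0 y) (sq_nonneg y)))).1 (hK2.const_mul C).2).ne
  · refine Eventually.of_forall fun y => ENNReal.Tendsto.const_mul ?_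
      (Or.inr ENNReal.ofReal_ne_top)
    refine tendsto_lintegral_filter_of_dominated_convergence
      (fun _ => ENNReal.ofReal (C * y ^ 2)) (Eventually.of_forall fun h =>
        (measurable_gap hψ (Lp_measurable v) measurable_const measurable_id).const_mul _)
      ?_ ?_ (Eventually.of_forall fun τ => tendsto_gap hψ hγ0 hγ hw y τ)
    · filter_upwards [hpos] with h hh using hin h hh y
    · simp

end Upper

/-! ### Γ-convergence -/

section Gamma

variable {ψ f K : ℝ → ℝ} {γ : ℝ}

theorem le_rateFunctional (hψ : Continuous ψ) (hγ0 : 0 < γ) (hγ : ∀ t, γ ≤ ψ t)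
    (hf : ∀ t, f |t| = potential ψ t) (hK0 : ∀ z, 0 ≤ K z) (hKi : Integrable K)
    (hKpos : ¬ ∀ᵐ z, K z = 0) {h : ℝ} (hh : 0 < h) (u : H1) :
    ((∫⁻ y, ENNReal.ofReal (K y) * ∫⁻ τ in Ioc (0 : ℝ) 1,
      ENNReal.ofReal (1 / h ^ 2) * gap ψ u.weakDeriv (h * y) τ : ENNReal) : EReal) ≤
      rateFunctional f K h u := by
  by_cases hu : ∫⁻ x, ENNReal.ofReal (potential ψ (u.weakDeriv x)) = ⊤
  · rw [rateFunctional_eq_top hψ hγ0 hγ hf hK0 hKi.aemeasurable hKpos hh u hu]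
    exact le_top
  · exact (rateFunctional_eq_lintegral_gap hψ hγ0 hγ hf hK0 hKi hh u hu).ge

theorem IsWeakDeriv.lintegral_potential_ne_top (hψ : Continuous ψ) {v w : L2R}
    (h : IsWeakDeriv v w) : ∫⁻ x, ENNReal.ofReal (potential ψ (v x)) ≠ ⊤ := by
  obtain ⟨R, hR⟩ := h.exists_bound
  obtain ⟨M, hM0, hM⟩ := exists_taylorWeight_le hψ |R|
  have hfin : ∫⁻ x, ENNReal.ofReal M * ENNReal.ofReal (v x ^ 2) ≠ ⊤ := by
    rw [lintegral_const_mul' _ _ ENNReal.ofReal_ne_top, lintegral_sq_eq]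
    exact ENNReal.mul_ne_top ENNReal.ofReal_ne_top ENNReal.ofReal_ne_top
  refine ne_top_of_le_ne_top hfin (lintegral_mono_ae ?_)
  filter_upwards [hR] with x hx
  rw [← ENNReal.ofReal_mul hM0, potential_eq_bregman hψ]
  exact ENNReal.ofReal_le_ofReal (mul_le_mul_of_nonneg_right
    (hM _ _ (by simp) (hx.trans (le_abs_self R))) (sq_nonneg _))

theorem integral_kernel_sq_pos (hK0 : ∀ z, 0 ≤ K z) (hK2 : Integrable fun z => K z * z ^ 2)
    (hKpos : ¬ ∀ᵐ z, K z = 0) : 0 < ∫ z, K z * z ^ 2 := by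
  have h0 : ∀ z, 0 ≤ K z * z ^ 2 := fun z => mul_nonneg (hK0 z) (sq_nonneg z)
  refine lt_of_le_of_ne (integral_nonneg h0) fun h => hKpos ?_
  have := (integral_eq_zero_iff_of_nonneg h0 hK2).1 h.symm
  filter_upwards [this, Measure.ae_ne volume 0] with z hz hz0
  exact (mul_eq_zero.1 hz).resolve_right (pow_ne_zero 2 hz0)

/-- The limit functional in terms of the second derivative extended evenly to the line. The two
sides agree also off `H²(ℝ)`, where both are `+∞`, because the second moment of `K` is positive. -/
theorem limitFunctional_eq (hK0 : ∀ z, 0 ≤ K z)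
    (hK2 : Integrable fun z => K z * z ^ 2) (hKpos : ¬ ∀ᵐ z, K z = 0) (u : H1) :
    limitFunctional f K u = ((ENNReal.ofReal (1 / 12 * ∫ z, K z * z ^ 2) *
      limitEnergy (fun t => iteratedDerivWithin 2 f (Ici 0) |t|) u.1.snd : ENNReal) : EReal) := by
  have hI := integral_kernel_sq_pos hK0 hK2 hKpos
  set I := ∫ z, K z * z ^ 2
  rw [limitFunctional]
  split_ifs with hu
  · have hw : IsWeakDeriv u.1.snd hu.choose := hu.choose_spec
    have hw2 : u.weakDeriv₂ = (hu.choose : L2R) := by rw [H1.weakDeriv₂, dif_pos hu]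
    have e : ∫⁻ x, ENNReal.ofReal
        (iteratedDerivWithin 2 f (Ici 0) |u.weakDeriv x| * |u.weakDeriv₂ x| ^ 2) =
        ENNReal.ofReal 2 * limitEnergy (fun t => iteratedDerivWithin 2 f (Ici 0) |t|) u.1.snd := by
      rw [limitEnergy_eq hw, ← lintegral_const_mul' _ _ ENNReal.ofReal_ne_top]
      refine lintegral_congr fun x => ?_
      rw [← ENNReal.ofReal_mul zero_le_two, hw2, sq_abs]
      congr 1
      simp only [H1.weakDeriv]
      ring
    have h24 : (0 : ℝ) ≤ 1 / 24 * I := by positivity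
    rw [e, ← max_eq_left h24, ← EReal.coe_ennreal_ofReal,
      ← EReal.coe_ennreal_mul, ← mul_assoc, ← ENNReal.ofReal_mul h24]
    congr 3
    ring
  · rw [limitEnergy_eq_top hu, ENNReal.mul_top]
    · rfl
    · simpa using hI

theorem tendsto_weakDeriv {X : Type*} {l : Filter X} {w : X → H1} {u : H1}
    (hw : Tendsto w l (𝓝 u)) : Tendsto (fun i => (w i).1.snd) l (𝓝 u.1.snd) := by
  have hc : Continuous fun u : H1 => u.1.snd :=
    (WithLp.prod_continuous_ofLp 2 L2R L2R).snd.comp continuous_subtype_val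
  exact (hc.tendsto u).comp hw

end Gamma

theorem mainTheorem3 (a b : ℝ) (hab : a < b)
    (K : ℝ → ℝ) (hKnonneg : ∀ z, 0 ≤ K z) (hKmeas : AEMeasurable K)
    (hKeven : ∀ᵐ z, K (-z) = K z)
    (hKmom : Integrable (fun z => K z * (1 + |z| ^ 2)))
    (hKpos : ¬ ∀ᵐ z, K z = 0)
    (f : ℝ → ℝ) (hfnonneg : ∀ t, 0 ≤ t → 0 ≤ f t)
    (hfC2 : ContDiffOn ℝ 2 f (Ici 0)) (hf0 : f 0 = 0) (hf'0 : derivWithin f (Ici 0) 0 = 0)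
    (γ : ℝ) (hγ : 0 < γ) (hfconv : ∀ t, 0 ≤ t → γ ≤ iteratedDerivWithin 2 f (Ici 0) t) :
    GammaConverges (𝓝[>] (0 : ℝ))
      (fun (h : ℝ) (u : SpaceX a b) => rateFunctional f K h u)
      (fun u : SpaceX a b => limitFunctional f K u) := by
  obtain ⟨hψ, hf⟩ := eq_potential_of_contDiffOn hfC2 hf0 hf'0
  have hψγ : ∀ t, γ ≤ iteratedDerivWithin 2 f (Ici 0) |t| := fun t => hfconv _ (abs_nonneg t)
  have hKi : Integrable K := by
    refine hKmom.mono' hKmeas.aestronglyMeasurable (Eventually.of_forall fun z => ?_)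
    rw [Real.norm_of_nonneg (hKnonneg z)]
    exact le_mul_of_one_le_right (hKnonneg z) (by linarith [sq_nonneg |z|])
  have hK2 : Integrable fun z => K z * z ^ 2 := by
    refine (hKmom.sub hKi).congr (Eventually.of_forall fun z => ?_)
    simp only [Pi.sub_apply, sq_abs]
    ring
  have hmono : Monotone ((↑) : ENNReal → EReal) :=
    fun _ _ h => EReal.coe_ennreal_le_coe_ennreal_iff.2 h
  have hcont : Continuous ((↑) : ENNReal → EReal) := continuous_coe_ennreal_ereal
  intro u
  simp only [limitFunctional_eq hKnonneg hK2 hKpos]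
  constructor
  · intro w hw
    have hv := tendsto_weakDeriv ((continuous_subtype_val.tendsto u).comp hw)
    refine (hmono (le_liminf_lintegral_gap hψ hγ hψγ hKnonneg hKmeas hK2 hv)).trans ?_
    rw [hmono.map_liminf_of_continuousAt _ hcont.continuousAt]
    refine liminf_le_liminf ?_
    filter_upwards [self_mem_nhdsWithin] with h hh
    exact le_rateFunctional hψ hγ hψγ hf hKnonneg hKi hKpos hh _
  · refine ⟨fun _ => u, tendsto_const_nhds, ?_⟩
    -- the constant family is a recovery family
    by_cases hu : ∃ w, IsWeakDeriv u.1.1.snd w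
    · obtain ⟨w, hw⟩ := hu
      have hlim := (hcont.tendsto _).comp
        (tendsto_lintegral_gap hψ hγ hψγ hKnonneg hKmeas hK2 hw)
      refine (Tendsto.limsup_eq (hlim.congr' ?_)).le
      filter_upwards [self_mem_nhdsWithin] with h hh
      exact (rateFunctional_eq_lintegral_gap hψ hγ hψγ hf hKnonneg hKi hh _
        (hw.lintegral_potential_ne_top hψ)).symm
    · rw [limitEnergy_eq_top hu, ENNReal.mul_top]
      · exact le_top
      · simpa using integral_kernel_sq_pos hKnonneg hK2 hKpos
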